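/- Let $n\ge 3$. Let $\widetilde\Delta$ be a finite disjoint union of oriented Euclidean $n$-simplices, and let $\Phi$ be a family of orientation-reversing affine isomorphisms, closed under inverses, that pairs each facet of $\widetilde\Delta$ with a different facet. Let $\widehat M=\widetilde\Delta/\Phi$ be the quotient space, with quotient map $p$; assume that $\widehat M$ is connected. Let $M$ be the complement in $\widehat M$ of the image of the set of vertices of $\widetilde\Delta$. A $k$-singlex is the image under $p$ of a $k$-simplex of $\widetilde\Delta$, its degree is the number of $k$-simplices of $\widetilde\Delta$ that $p$ maps onto it, and the triangulation is called even if each $(n-2)$-singlex has even degree. The dual graph in $M$ has the barycentres of the $n$-simplices as vertices, and for each pair of facets $\tau,\varphi(\tau)$ identified by $\varphi\in\Phi$ it has an edge, which joins the barycentres of the two incident $n$-simplices by straight segments through the common barycentre of the identified facets. The perspectivity $p_\tau$ across a facet $\tau$ of a simplex $\sigma$, paired by $\varphi$ with a facet $\varphi(\tau)$ of $\sigma'$, is the bijection from the vertices of $\sigma$ to those of $\sigma'$ that equals $\varphi$ on the vertices of $\tau$ and sends the vertex of $\sigma$ opposite to $\tau$ to the vertex of $\sigma'$ opposite to $\varphi(\tau)$.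 Fix an $n$-simplex $\sigma_0$ and let $x_0$ be the image of its barycentre. For an edge loop $\gamma$ at $x_0$ in the dual graph that crosses the facets $\tau_0,\dots,\tau_k$ in this order, the projectivity of $\gamma$ is $p_\gamma=p_{\tau_k}\circ\dots\circ p_{\tau_0}\in\mathrm{Sym}(\sigma_0)\cong\mathrm{Sym}(n+1)$ (the identity for the constant loop). Consider the assignment $$\pi_1(M,x_0)\ni[\gamma]\longmapsto p_\gamma\in\mathrm{Sym}(\sigma_0).\qquad(*)$$ (1) If $(*)$ is a well-defined homomorphism on $\pi_1(M,x_0)$, then the triangulation is even. (2) Conversely, if the triangulation is even, and if $n=3$ or $M$ is a PL $n$-manifold with respect to the triangulation (each point of $M$ has a chart to $\mathbb R^n$ that is piecewise affine on the simplices), then $(*)$ is a well-defined homomorphism. In particular, if $n=3$ or $M$ is a PL $n$-manifold with respect to the triangulation, then $(*)$ is a well-defined homomorphism if and only if the triangulation is even. (The product of $\pi_1(M,x_0)$ is written here in the same order as the composition of permutations: $[\gamma][\delta]$ is the class of $\delta$ followed by $\gamma$.) -/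

import Mathlib

open Topology

/-- Points of the standard Euclidean `n`-simplex, in barycentric coordinates indexed by its
vertices `0, …, n`. -/
abbrev Simplex (n : ℕ) : Type := stdSimplex ℝ (Fin (n + 1))

/-- A facet of the disjoint union of the simplices `σ_t`, `t : T`: the pair `(t, i)` is the
facet of `σ_t` opposite to its corner `i`. -/
abbrev Facet (n : ℕ) (T : Type*) : Type _ := T × Fin (n + 1)

/-- A family of affine isomorphisms pairing the facets of the `n`-simplices `σ_t`, `t : T`.
The facet `f` is paired with the facet `partner f ≠ f`; the affine isomorphism between the two
is given by the bijection `vertexMap f` between their vertices. The family is closed under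
inverses. -/
structure FacePairing (n : ℕ) (T : Type*) where
  partner : Facet n T → Facet n T
  partner_ne : ∀ f, partner f ≠ f
  partner_partner : ∀ f, partner (partner f) = f
  vertexMap : ∀ f : Facet n T, {j : Fin (n + 1) // j ≠ f.2} ≃ {j : Fin (n + 1) // j ≠ (partner f).2}
  vertexMap_vertexMap : ∀ f j, (vertexMap (partner f) (vertexMap f j)).1 = j.1

namespace FacePairing

variable {n : ℕ} {T : Type*} (K : FacePairing n T)

/-- The perspectivity across the facet `f`, as a map on vertices: it is the face pairing on the
vertices of `f`, and sends the corner opposite to `f` to the corner opposite to `partner f`. -/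
def perspFun (f : Facet n T) (j : Fin (n + 1)) : Fin (n + 1) :=
  if h : j ≠ f.2 then (K.vertexMap f ⟨j, h⟩).1 else (K.partner f).2

theorem perspFun_of_ne (f : Facet n T) {j : Fin (n + 1)} (h : j ≠ f.2) :
    K.perspFun f j = (K.vertexMap f ⟨j, h⟩).1 := dif_pos h

theorem perspFun_opposite (f : Facet n T) : K.perspFun f f.2 = (K.partner f).2 :=
  dif_neg (fun h => h rfl)

/-- The perspectivity across the partner facet is the inverse perspectivity. -/
theorem perspFun_perspFun (f : Facet n T) (j : Fin (n + 1)) :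
    K.perspFun (K.partner f) (K.perspFun f j) = j := by
  by_cases h : j = f.2
  · subst h
    rw [perspFun_opposite, perspFun_opposite, K.partner_partner]
  · rw [K.perspFun_of_ne f h, K.perspFun_of_ne (K.partner f) (K.vertexMap f ⟨j, h⟩).2]
    exact K.vertexMap_vertexMap f ⟨j, h⟩

/-- The perspectivity across the facet `f = (t, i)`, a bijection from the vertices of `σ_t` to
the vertices of the simplex on the other side of `f`. -/
def perspectivity (f : Facet n T) : Equiv.Perm (Fin (n + 1)) where
  toFun := K.perspFun f
  invFun := K.perspFun (K.partner f)
  left_inv := K.perspFun_perspFun f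
  right_inv := fun j => by
    have h := K.perspFun_perspFun (K.partner f) j
    rwa [K.partner_partner f] at h

end FacePairing

/-- A (singular) triangulation of an oriented `n`-dimensional pseudo-manifold: oriented
`n`-simplices `σ_t`, `t : T`, with orientation-reversing face pairings. The value
`orientation t` compares the orientation of `σ_t` with the one given by the order of its
vertices. A face pairing reverses the boundary orientations of the facets if and only if the
affine isomorphism of simplices that extends it by sending the opposite corner to the opposite
corner (the perspectivity) reverses the orientations of the simplices. -/
structure Triangulation (n : ℕ) (T : Type*) extends FacePairing n T where
  orientation : T → ℤˣ
  orientation_reversing : ∀ f : Facet n T,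
    Equiv.Perm.sign (toFacePairing.perspectivity f) * orientation f.1 *
      orientation (partner f).1 = -1

namespace Triangulation

variable {n : ℕ} {T : Type*} (K : Triangulation n T)

/-- The disjoint union of the `n`-simplices, with the disjoint union topology. -/
abbrev Points (_K : Triangulation n T) : Type _ := Σ _ : T, Simplex n

/-- `x` lies on some facet, and the face pairing of that facet sends `x` to `y`. -/
def Glued (x y : K.Points) : Prop :=
  ∃ f : Facet n T, x.1 = f.1 ∧ y.1 = (K.partner f).1 ∧ x.2.1 f.2 = 0 ∧
    y.2.1 (K.partner f).2 = 0 ∧ ∀ j, y.2.1 (K.vertexMap f j).1 = x.2.1 j.1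

/-- The pseudo-manifold: the quotient of the disjoint union of the simplices by the equivalence
relation generated by the face pairings, with the quotient topology. -/
def Space : Type _ := Quot K.Glued

instance : TopologicalSpace K.Space := inferInstanceAs (TopologicalSpace (Quot K.Glued))

/-- The quotient map `p`. -/
def proj : K.Points → K.Space := Quot.mk K.Glued

theorem continuous_proj : Continuous K.proj := continuous_quot_mk

/-- The closed simplex of the disjoint union spanned by the vertices of `σ_t` in `F`. -/
def face (t : T) (F : Finset (Fin (n + 1))) : Set K.Points :=
  {x | x.1 = t ∧ ∀ j, j ∉ F → x.2.1 j = 0}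

/-- A `k`-singlex: the image of a `k`-simplex under the quotient map. -/
def IsSinglex (k : ℕ) (S : Set K.Space) : Prop :=
  ∃ (t : T) (F : Finset (Fin (n + 1))), F.card = k + 1 ∧ K.proj '' K.face t F = S

/-- The degree of a `k`-singlex `S`: the number of sheets of `p` over it, that is, the number of
`k`-simplices of the disjoint union that `p` maps onto `S`. -/
noncomputable def degree (k : ℕ) (S : Set K.Space) : ℕ :=
  Nat.card {c : T × Finset (Fin (n + 1)) // c.2.card = k + 1 ∧ K.proj '' K.face c.1 c.2 = S}

/-- The triangulation is even if each `(n-2)`-singlex has even degree. -/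
def IsEven : Prop := ∀ S : Set K.Space, K.IsSinglex (n - 2) S → Even (K.degree (n - 2) S)

/-- The `k`-skeleton of the disjoint union of the simplices. -/
def skeleton (k : ℕ) : Set K.Points :=
  {x | ∃ (t : T) (F : Finset (Fin (n + 1))), F.card = k + 1 ∧ x ∈ K.face t F}

/-- `M`: the complement of the image of the `0`-skeleton. -/
def M : Type _ := {x : K.Space // x ∉ K.proj '' K.skeleton 0}

instance : TopologicalSpace K.M :=
  inferInstanceAs (TopologicalSpace {x : K.Space // x ∉ K.proj '' K.skeleton 0})

theorem mem_skeleton_zero {x : K.Points} :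
    x ∈ K.skeleton 0 ↔ ∃ i, ∀ j, j ≠ i → x.2.1 j = 0 := by
  constructor
  · rintro ⟨t, F, hF, -, h⟩
    obtain ⟨i, rfl⟩ := Finset.card_eq_one.1 hF
    exact ⟨i, fun j hj => h j (by simpa using hj)⟩
  · rintro ⟨i, h⟩
    exact ⟨x.1, {i}, by simp, rfl, fun j hj => h j (by simpa using hj)⟩

theorem Glued.symm {x y : K.Points} (h : K.Glued x y) : K.Glued y x := by
  obtain ⟨f, h1, h2, h3, h4, h5⟩ := h
  refine ⟨K.partner f, h2, ?_, h4, ?_, fun j => ?_⟩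
  · rw [K.partner_partner]; exact h1
  · rw [K.partner_partner]; exact h3
  · obtain ⟨l, rfl⟩ := (K.vertexMap f).surjective j
    rw [K.vertexMap_vertexMap, h5]

theorem Glued.mem_skeleton_zero {x y : K.Points} (h : K.Glued x y) (hx : x ∈ K.skeleton 0) :
    y ∈ K.skeleton 0 := by
  rw [Triangulation.mem_skeleton_zero] at hx ⊢
  obtain ⟨f, -, -, h3, h4, h5⟩ := h
  obtain ⟨i, hi⟩ := hx
  have hif : i ≠ f.2 := by
    rintro rfl
    have hs := x.2.2.2
    rw [Finset.sum_eq_zero] at hs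
    · exact zero_ne_one hs
    · intro j _
      by_cases hj : j = f.2
      · rw [hj]; exact h3
      · exact hi j hj
  refine ⟨(K.vertexMap f ⟨i, hif⟩).1, fun j hj => ?_⟩
  by_cases hjf : j = (K.partner f).2
  · rw [hjf]; exact h4
  · obtain ⟨l, hl⟩ := (K.vertexMap f).surjective ⟨j, hjf⟩
    have hl' : (K.vertexMap f l).1 = j := congrArg Subtype.val hl
    rw [← hl', h5]
    refine hi _ fun hli => hj ?_
    rw [← hl']
    congr 2
    exact Subtype.ext hli

/-- A point of the disjoint union which is not a corner is mapped into `M`. -/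
theorem proj_notMem {x : K.Points} (hx : x ∉ K.skeleton 0) :
    K.proj x ∉ K.proj '' K.skeleton 0 := by
  rintro ⟨y, hy, hyx⟩
  have key : ∀ a b : K.Points, Relation.EqvGen K.Glued a b →
      (a ∈ K.skeleton 0 ↔ b ∈ K.skeleton 0) := by
    intro a b hab
    induction hab with
    | rel a b h => exact ⟨h.mem_skeleton_zero, h.symm.mem_skeleton_zero⟩
    | refl a => exact Iff.rfl
    | symm a b _ ih => exact ih.symm
    | trans a b c _ _ ih1 ih2 => exact ih1.trans ih2
  exact hx ((key y x (Quot.eqvGen_exact hyx)).1 hy)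

/-- The barycentre of the `n`-simplex. -/
noncomputable def barycentre (n : ℕ) : Simplex n :=
  ⟨fun _ => 1 / ((n : ℝ) + 1), fun _ => by positivity, by
    simp only [Finset.sum_const, Finset.card_univ, Fintype.card_fin, nsmul_eq_mul]
    push_cast
    field_simp⟩

/-- The barycentre of the facet of the `n`-simplex opposite to the corner `i`. -/
noncomputable def facetBarycentre (hn : 3 ≤ n) (i : Fin (n + 1)) : Simplex n :=
  ⟨fun j => if j = i then 0 else 1 / (n : ℝ), fun j => by dsimp only; split_ifs <;> positivity, by
    have h0 : (n : ℝ) ≠ 0 := by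
      have : 0 < n := by omega
      positivity
    rw [← Finset.add_sum_erase _ _ (Finset.mem_univ i), if_pos rfl, zero_add,
      Finset.sum_congr rfl (g := fun _ => 1 / (n : ℝ))
        (fun j hj => if_neg (Finset.ne_of_mem_erase hj))]
    simp [Finset.card_erase_of_mem, h0]⟩

/-- The point at time `s` on the straight segment from the barycentre of the `n`-simplex to the
barycentre of its facet opposite to `i`. -/
noncomputable def segmentPoint (hn : 3 ≤ n) (i : Fin (n + 1)) (s : unitInterval) : Simplex n :=
  ⟨(1 - s.1) • (barycentre n).1 + s.1 • (facetBarycentre hn i).1,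
    convex_stdSimplex ℝ _ (barycentre n).2 (facetBarycentre hn i).2
      (by linarith [s.2.2]) s.2.1 (by ring)⟩

theorem continuous_segmentPoint (hn : 3 ≤ n) (i : Fin (n + 1)) :
    Continuous (segmentPoint hn i) := by
  unfold segmentPoint
  refine Continuous.subtype_mk ?_ _
  fun_prop

theorem segmentPoint_zero (hn : 3 ≤ n) (i : Fin (n + 1)) : segmentPoint hn i 0 = barycentre n := by
  apply Subtype.ext
  simp [segmentPoint]

theorem segmentPoint_one (hn : 3 ≤ n) (i : Fin (n + 1)) :
    segmentPoint hn i 1 = facetBarycentre hn i := by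
  apply Subtype.ext
  simp [segmentPoint]

theorem segmentPoint_pos (hn : 3 ≤ n) (i : Fin (n + 1)) (s : unitInterval) {j : Fin (n + 1)}
    (hj : j ≠ i) : 0 < (segmentPoint hn i s).1 j := by
  have h0 : (0 : ℝ) < n := by
    have : 0 < n := by omega
    positivity
  have e : (segmentPoint hn i s).1 j = (1 - s.1) * (1 / ((n : ℝ) + 1)) + s.1 * (1 / (n : ℝ)) := by
    simp [segmentPoint, barycentre, facetBarycentre, hj]
  rw [e]
  have h1 : 0 < 1 / ((n : ℝ) + 1) := by positivity
  have h2 : 0 < 1 / (n : ℝ) := by positivity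
  rcases eq_or_lt_of_le s.2.1 with h | h
  · rw [← h]; simpa using h1
  · have h3 : 0 ≤ (1 - s.1) * (1 / ((n : ℝ) + 1)) := mul_nonneg (by linarith [s.2.2]) h1.le
    have h4 := mul_pos h h2
    linarith

theorem segmentPoint_notMem (hn : 3 ≤ n) (f : Facet n T) (s : unitInterval) :
    (⟨f.1, segmentPoint hn f.2 s⟩ : K.Points) ∉ K.skeleton 0 := by
  rw [mem_skeleton_zero]
  rintro ⟨k, hk⟩
  obtain ⟨j, hj⟩ : ∃ j : Fin (n + 1), j ∉ ({f.2, k} : Finset (Fin (n + 1))) := by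
    by_contra hall
    push Not at hall
    have hc := Finset.card_le_card (fun x _ => hall x : Finset.univ ⊆ _)
    have := Finset.card_le_two (a := f.2) (b := k)
    simp only [Finset.card_univ, Fintype.card_fin] at hc
    omega
  simp only [Finset.mem_insert, Finset.mem_singleton, not_or] at hj
  exact (segmentPoint_pos hn f.2 s hj.1).ne' (hk j hj.2)

/-- The point of `M` at time `s` on the segment from the barycentre of `σ_t` to the barycentre
of its facet `f = (t, i)`. -/
noncomputable def halfEdgePoint (hn : 3 ≤ n) (f : Facet n T) (s : unitInterval) : K.M :=
  ⟨K.proj ⟨f.1, segmentPoint hn f.2 s⟩, K.proj_notMem (K.segmentPoint_notMem hn f s)⟩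

/-- The vertex of the dual graph in the simplex `σ_t`: the image of the barycentre of `σ_t`. -/
noncomputable def dualVertex (hn : 3 ≤ n) (t : T) : K.M :=
  ⟨K.proj ⟨t, barycentre n⟩, by
    have h := (K.halfEdgePoint hn (t, 0) 0).2
    simpa only [halfEdgePoint, segmentPoint_zero] using h⟩

/-- The image in `M` of the barycentre of the facet `f`. -/
noncomputable def facetPoint (hn : 3 ≤ n) (f : Facet n T) : K.M :=
  ⟨K.proj ⟨f.1, facetBarycentre hn f.2⟩, by
    have h := (K.halfEdgePoint hn f 1).2
    simpa only [halfEdgePoint, segmentPoint_one] using h⟩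

theorem facetPoint_partner (hn : 3 ≤ n) (f : Facet n T) :
    K.facetPoint hn (K.partner f) = K.facetPoint hn f := by
  apply Subtype.ext
  refine (Quot.sound ⟨f, rfl, rfl, ?_, ?_, fun j => ?_⟩ : K.proj _ = K.proj _).symm
  · simp [facetBarycentre]
  · simp [facetBarycentre]
  · simp [facetBarycentre, j.2, (K.vertexMap f j).2]

/-- Half of an edge of the dual graph: the image of the straight segment from the barycentre of
`σ_t` to the barycentre of its facet `f = (t, i)`. -/
noncomputable def halfEdge (hn : 3 ≤ n) (f : Facet n T) :
    Path (K.dualVertex hn f.1) (K.facetPoint hn f) where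
  toFun := K.halfEdgePoint hn f
  continuous_toFun := by
    refine Continuous.subtype_mk (K.continuous_proj.comp ?_) _
    exact continuous_sigmaMk.comp (continuous_segmentPoint hn f.2)
  source' := by
    apply Subtype.ext
    simp only [halfEdgePoint, dualVertex, segmentPoint_zero]
  target' := by
    apply Subtype.ext
    simp only [halfEdgePoint, facetPoint, segmentPoint_one]

/-- The edge of the dual graph crossing the facet `f`. -/
noncomputable def dualEdge (hn : 3 ≤ n) (f : Facet n T) :
    Path (K.dualVertex hn f.1) (K.dualVertex hn (K.partner f).1) :=
  (K.halfEdge hn f).trans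
    ((K.halfEdge hn (K.partner f)).symm.cast (K.facetPoint_partner hn f).symm rfl)

/-- Edge paths in the dual graph from the simplex `σ_t` to the simplex `σ_{t'}`, recorded by the
facets that they cross, in order. -/
inductive DualPath : T → T → Type _
  | nil (t : T) : DualPath t t
  | cons (f : Facet n T) {t' : T} (rest : DualPath (K.partner f).1 t') : DualPath f.1 t'

namespace DualPath

variable {K}

/-- The path in `M` that runs along the edges of the dual graph. -/
noncomputable def toPath (hn : 3 ≤ n) :
    {t t' : T} → K.DualPath t t' → Path (K.dualVertex hn t) (K.dualVertex hn t')
  | _, _, .nil t => Path.refl (K.dualVertex hn t)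
  | _, _, .cons f rest => (K.dualEdge hn f).trans (rest.toPath hn)

/-- The projectivity along an edge path: the composite of the perspectivities across the facets
that it crosses, the first facet acting first. -/
def projectivity : {t t' : T} → K.DualPath t t' → Equiv.Perm (Fin (n + 1))
  | _, _, .nil _ => 1
  | _, _, .cons f rest => rest.projectivity * K.perspectivity f

end DualPath

/-- The assignment `[γ] ↦ p_γ`, with `γ` running over the loops at `x₀` in the dual graph, is a
well-defined map on the fundamental group of `M`, and this map is the homomorphism `ρ`. Here
`x₀` is the barycentre of `σ_{t₀}`, and both products are in the order in which the right
factor comes first: `[γ] * [δ]` is the class of `δ` followed by `γ`. -/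
def IsCanonicalRep (hn : 3 ≤ n) (t₀ : T)
    (ρ : FundamentalGroup K.M (K.dualVertex hn t₀) →* Equiv.Perm (Fin (n + 1))) : Prop :=
  ∀ a s, ρ a = s ↔ ∃ γ : K.DualPath t₀ t₀,
    FundamentalGroup.fromPath (Path.Homotopic.Quotient.mk (γ.toPath hn)) = a ∧ γ.projectivity = s

/-- `M` is a PL `n`-manifold with respect to the triangulation: around every point there is a
chart which, on each `n`-simplex, is piecewise affine, that is (being continuous), locally given
at each point by one out of finitely many affine maps. -/
def IsPLManifold : Prop :=
  ∀ x : K.M, ∃ e : OpenPartialHomeomorph K.M (EuclideanSpace ℝ (Fin n)), x ∈ e.source ∧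
    ∀ (t : T) (a : Simplex n), (∃ u ∈ e.source, u.1 = K.proj ⟨t, a⟩) →
      ∃ W ∈ 𝓝 a, ∃ A : Set ((Fin (n + 1) → ℝ) →ᵃ[ℝ] EuclideanSpace ℝ (Fin n)), A.Finite ∧
        ∀ b ∈ W, ∀ u ∈ e.source, u.1 = K.proj ⟨t, b⟩ → ∃ L ∈ A, e u = L b.1

end Triangulation

/-! Take one copy of each simplex for every label in Sym(n+1), and let the crossing of a facet
multiply the label by the perspectivity. The copies glue to a space over the pseudo-manifold
(`cover`, `forget`), on which Sym(n+1) acts through right multiplication of labels. An edge path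
lifts to this space and multiplies the label by its projectivity. A point is good (`IsGood`) if no
gluing identifies two differently labelled copies of one point over it. Over the good points
`forget` is a covering (`isQuotientCoveringMap_goodForget`), so there homotopic paths have lifts
with the same end (`eq_of_homotopic_forget`). Every class of loops in `M` contains an edge loop
(`exists_dualPath_eq`). Hence the projectivities represent the fundamental group as soon as all
points of `M` are good (`exists_isCanonicalRep`).

A circuit around a codimension two face contracts to the barycentre of that face, which is not a
vertex because n ≥ 3. Read through the labels, each crossing in this circuit exchanges the two
corners outside the face (`flagLabel_rot`). An odd degree would therefore give a null-homotopic edge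
loop with nontrivial projectivity (`IsCanonicalRep.isEven`).

If the degrees are even, a circuit fixes these two corners, and by orientability it acts as an even
permutation. For n = 3 only two corners remain, so it acts trivially. For larger n it may permute
the corners of the face, but a bad point in the relative interior is fixed by a nontrivial such
permutation and so has two equal nonzero coordinates (`isGood_of_hasZeros`). The bad points thus lie
in affine pieces of codimension three (`exists_subspace_of_not_isGood`). Near a point x of a PL
manifold, push the dual graph towards x. In a chart, the cone on this graph from a generic apex
misses the bad points, because 1 + 1 + (n - 3) < n (`exists_apex`). Loops in the pushed graph
realise every change of label at x and are null-homotopic among good points, so x is good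
(`IsPLManifold.isGood`). -/

namespace FacePairing

/-! ### Labelled simplices and good points. -/

variable {n : ℕ} {T : Type*} (K : FacePairing n T)

theorem perspectivity_opposite (f : Facet n T) : K.perspectivity f f.2 = (K.partner f).2 :=
  K.perspFun_opposite f

theorem perspectivity_partner (f : Facet n T) :
    K.perspectivity (K.partner f) = (K.perspectivity f)⁻¹ := by
  rw [eq_inv_iff_mul_eq_one]
  ext j
  exact congrArg Fin.val (K.perspFun_perspFun f j)

/-- The face pairing of the simplices labelled by permutations of the vertices, where crossing a
facet multiplies the label by the perspectivity across this facet. -/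
def cover : FacePairing n (T × Equiv.Perm (Fin (n + 1))) where
  partner f := (((K.partner (f.1.1, f.2)).1, K.perspectivity (f.1.1, f.2) * f.1.2),
    (K.partner (f.1.1, f.2)).2)
  partner_ne f h := K.partner_ne (f.1.1, f.2)
    (Prod.ext (congrArg (fun g => g.1.1) h) (congrArg (fun g => g.2) h))
  partner_partner f := by
    obtain ⟨⟨t, s⟩, i⟩ := f
    simp only [Prod.mk.eta, K.partner_partner, K.perspectivity_partner, inv_mul_cancel_left]
  vertexMap f := K.vertexMap (f.1.1, f.2)
  vertexMap_vertexMap f j := K.vertexMap_vertexMap (f.1.1, f.2) j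

theorem cover_perspectivity (f : Facet n (T × Equiv.Perm (Fin (n + 1)))) :
    K.cover.perspectivity f = K.perspectivity (f.1.1, f.2) := by
  ext j
  rfl

end FacePairing

/-- The affine automorphism of the simplex that permutes the vertices by `σ`. -/
def Simplex.permute {n : ℕ} (σ : Equiv.Perm (Fin (n + 1))) (a : Simplex n) : Simplex n :=
  ⟨fun j => a.1 (σ⁻¹ j), fun j => a.2.1 _, by
    rw [← a.2.2]; exact Equiv.sum_comp σ⁻¹ a.1⟩

namespace Simplex

variable {n : ℕ}

theorem permute_apply (σ : Equiv.Perm (Fin (n + 1))) (a : Simplex n) (j : Fin (n + 1)) :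
    (permute σ a).1 j = a.1 (σ⁻¹ j) := rfl

@[simp] theorem permute_apply_apply (σ : Equiv.Perm (Fin (n + 1))) (a : Simplex n)
    (j : Fin (n + 1)) : (permute σ a).1 (σ j) = a.1 j := by
  simp [permute_apply]

theorem permute_one (a : Simplex n) : permute 1 a = a := rfl

theorem permute_mul (σ τ : Equiv.Perm (Fin (n + 1))) (a : Simplex n) :
    permute (σ * τ) a = permute σ (permute τ a) := by
  refine Subtype.ext (funext fun j => ?_)
  simp only [permute_apply, mul_inv_rev, Equiv.Perm.mul_apply]

end Simplex

namespace Triangulation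

open Simplex

variable {n : ℕ} {T : Type*} (K : Triangulation n T)

/-- The triangulation by the simplices labelled by permutations. -/
def cover : Triangulation n (T × Equiv.Perm (Fin (n + 1))) where
  __ := K.toFacePairing.cover
  orientation t := K.orientation t.1
  orientation_reversing f := by
    rw [FacePairing.cover_perspectivity]
    exact K.orientation_reversing (f.1.1, f.2)

/-- On a facet the coordinate of the opposite corner vanishes on both sides, so the face pairing may
be replaced by the perspectivity acting on all coordinates. -/
theorem glued_iff {x y : K.Points} : K.Glued x y ↔ ∃ i, x.2.1 i = 0 ∧
    y = ⟨(K.partner (x.1, i)).1, permute (K.perspectivity (x.1, i)) x.2⟩ := by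
  constructor
  · rintro ⟨⟨t, i⟩, h1, h2, h3, h4, h5⟩
    obtain ⟨t', a⟩ := x
    obtain ⟨t'', b⟩ := y
    dsimp only at h1 h2 h3 h4 h5
    subst h1 h2
    refine ⟨i, h3, ?_⟩
    congr 1
    refine Subtype.ext (funext fun j => ?_)
    obtain ⟨j, rfl⟩ := (K.perspectivity (t', i)).surjective j
    dsimp only
    rw [permute_apply_apply]
    by_cases hj : j = i
    · subst hj
      rw [h3]
      exact (congrArg b.1 (K.perspectivity_opposite (t', j))).trans h4
    · rw [← h5 ⟨j, hj⟩]
      exact congrArg b.1 (K.perspFun_of_ne (t', i) hj)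
  · rintro ⟨i, h, rfl⟩
    refine ⟨(x.1, i), rfl, rfl, h, ?_, fun j => ?_⟩
    · rw [← h]
      dsimp only
      rw [← K.perspectivity_opposite (x.1, i), permute_apply_apply]
    · have : (K.vertexMap (x.1, i) j).1 = K.perspectivity (x.1, i) j.1 :=
        (K.perspFun_of_ne (x.1, i) j.2).symm
      rw [this, permute_apply_apply]

theorem proj_eq_iff {x y : K.Points} :
    K.proj x = K.proj y ↔ Relation.ReflTransGen K.Glued x y := by
  constructor
  · intro h
    have h' := Quot.eqvGen_exact h
    clear h
    induction h' with
    | rel a b h => exact .single h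
    | refl a => exact .refl
    | symm a b _ ih =>
      have : Std.Symm K.Glued := ⟨fun _ _ h => h.symm⟩
      exact symm ih
    | trans a b c _ _ ih1 ih2 =>
      exact ih1.trans ih2
  · intro h
    induction h with
    | refl => rfl
    | tail _ h ih => exact ih.trans (Quot.sound h)

/-- A relation on points that is preserved by gluing the second point is satisfied by all points
with the same image. -/
theorem proj_eq_induction {x : K.Points} {p : K.Points → Prop} (hx : p x)
    (h : ∀ y i, p y → y.2.1 i = 0 →
      p ⟨(K.partner (y.1, i)).1, permute (K.perspectivity (y.1, i)) y.2⟩)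
    {y : K.Points} (hxy : K.proj x = K.proj y) : p y := by
  rw [proj_eq_iff] at hxy
  induction hxy with
  | refl => exact hx
  | tail _ hg ih =>
    obtain ⟨i, hi, rfl⟩ := K.glued_iff.1 hg
    exact h _ i ih hi

theorem proj_cross (t : T) (a : Simplex n) {i : Fin (n + 1)} (h : a.1 i = 0) :
    K.proj ⟨(K.partner (t, i)).1, permute (K.perspectivity (t, i)) a⟩ = K.proj ⟨t, a⟩ :=
  (Quot.sound ((K.glued_iff (x := ⟨t, a⟩)).2 ⟨i, h, rfl⟩)).symm

theorem cover_perspectivity (f : Facet n (T × Equiv.Perm (Fin (n + 1)))) :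
    K.cover.perspectivity f = K.perspectivity (f.1.1, f.2) :=
  K.toFacePairing.cover_perspectivity f

/-- The image in the labelled space of the point `a` of the simplex `σ_t` with the label `s`. -/
def lift (t : T) (s : Equiv.Perm (Fin (n + 1))) (a : Simplex n) : K.cover.Space :=
  K.cover.proj ⟨(t, s), a⟩

theorem lift_cross (t : T) (s : Equiv.Perm (Fin (n + 1))) (a : Simplex n) {i : Fin (n + 1)}
    (h : a.1 i = 0) :
    K.lift (K.partner (t, i)).1 (K.perspectivity (t, i) * s)
      (permute (K.perspectivity (t, i)) a) = K.lift t s a := by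
  have := K.cover.proj_cross (t, s) a h
  rw [cover_perspectivity] at this
  exact this

theorem lift_eq_induction {t : T} {s : Equiv.Perm (Fin (n + 1))} {a : Simplex n}
    {p : T → Equiv.Perm (Fin (n + 1)) → Simplex n → Prop} (hx : p t s a)
    (h : ∀ t s a i, p t s a → a.1 i = 0 → p (K.partner (t, i)).1
      (K.perspectivity (t, i) * s) (permute (K.perspectivity (t, i)) a))
    {t' : T} {s' : Equiv.Perm (Fin (n + 1))} {a' : Simplex n}
    (hxy : K.lift t s a = K.lift t' s' a') : p t' s' a' :=
  K.cover.proj_eq_induction (x := ⟨(t, s), a⟩) (y := ⟨(t', s'), a'⟩)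
    (p := fun y => p y.1.1 y.1.2 y.2) hx (fun y i hy hi => by
      have := h y.1.1 y.1.2 y.2 i hy hi
      rw [cover_perspectivity]
      exact this) hxy

theorem lift_surjective (x : K.cover.Space) : ∃ t s a, K.lift t s a = x := by
  obtain ⟨⟨⟨t, s⟩, a⟩, rfl⟩ := Quot.exists_rep x
  exact ⟨t, s, a, rfl⟩

/-- The map that forgets the labels. -/
def forget : K.cover.Space → K.Space :=
  Quot.lift (fun x => K.proj ⟨x.1.1, x.2⟩) fun x y h => by
    obtain ⟨i, hi, rfl⟩ := K.cover.glued_iff.1 h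
    rw [cover_perspectivity]
    exact (K.proj_cross x.1.1 x.2 hi).symm

theorem continuous_forget : Continuous K.forget := by
  refine continuous_quot_lift _ (K.continuous_proj.comp ?_)
  exact continuous_sigma fun t => continuous_sigmaMk (σ := fun _ : T => Simplex n) (i := t.1)

/-- Each crossing applies the same perspectivity to the coordinates and to the label, so the change
of label records the motion of the point. -/
theorem lift_eq_permute {t t' : T} {s s' : Equiv.Perm (Fin (n + 1))} {a a' : Simplex n}
    (h : K.lift t s a = K.lift t' s' a') : a' = permute (s' * s⁻¹) a :=
  K.lift_eq_induction (t := t) (s := s) (a := a) (p := fun t' s' a' => a' = permute (s' * s⁻¹) a)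
    (by rw [mul_inv_cancel, permute_one])
    (fun t' s' a' i h _ => by rw [mul_assoc, permute_mul, ← h]) h

theorem exists_lift_eq {t t' : T} {a a' : Simplex n} (h : K.proj ⟨t, a⟩ = K.proj ⟨t', a'⟩)
    (s : Equiv.Perm (Fin (n + 1))) : ∃ s', K.lift t s a = K.lift t' s' a' :=
  K.proj_eq_induction (x := ⟨t, a⟩) (y := ⟨t', a'⟩)
    (p := fun y => ∃ s', K.lift t s a = K.lift y.1 s' y.2) ⟨s, rfl⟩
    (fun y i ⟨s', hs'⟩ hi => ⟨K.perspectivity (y.1, i) * s',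
      hs'.trans (K.lift_cross y.1 s' y.2 hi).symm⟩) h

theorem lift_mul_right {t t' : T} {s s' : Equiv.Perm (Fin (n + 1))} {a a' : Simplex n}
    (h : K.lift t s a = K.lift t' s' a') (g : Equiv.Perm (Fin (n + 1))) :
    K.lift t (s * g) a = K.lift t' (s' * g) a' :=
  K.lift_eq_induction (p := fun t' s' a' => K.lift t (s * g) a = K.lift t' (s' * g) a') rfl
    (fun t' s' a' i h hi => by rw [h, mul_assoc, K.lift_cross _ _ _ hi]) h

theorem finite_fibre [Finite T] (x : K.Space) : {y : K.Points | K.proj y = x}.Finite := by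
  obtain ⟨⟨t, a⟩, rfl⟩ := Quot.exists_rep x
  refine (Set.finite_range fun c : T × Equiv.Perm (Fin (n + 1)) =>
    (⟨c.1, permute c.2 a⟩ : K.Points)).subset ?_
  rintro ⟨t', a'⟩ h
  obtain ⟨s', hs'⟩ := K.exists_lift_eq (t := t) (t' := t') (a := a) (a' := a') h.symm 1
  exact ⟨(t', s'), by simp [K.lift_eq_permute hs']⟩

/-- All labelled points over `x` in the same position have the same label. -/
def IsGood (x : K.Space) : Prop :=
  ∀ t a s s', K.proj ⟨t, a⟩ = x → K.lift t s a = K.lift t s' a → s = s'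

/-- Identifications of labelled points are invariant under right multiplication of labels, so a
coincidence at another representative is transported to `a`. -/
theorem isGood_of_forall {t : T} {a : Simplex n}
    (h : ∀ s s', K.lift t s a = K.lift t s' a → s = s') : K.IsGood (K.proj ⟨t, a⟩) := by
  intro t' a' s s' ht hs
  obtain ⟨u, hu⟩ := K.exists_lift_eq ht s
  have h2 := K.lift_mul_right hu (s⁻¹ * s')
  rw [mul_inv_cancel_left, ← hs, hu] at h2
  have := h _ _ h2
  rwa [left_eq_mul, inv_mul_eq_one] at this

end Triangulation

/-! ### Small neighbourhoods, and the covering over the good points. -/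

namespace Triangulation

open Simplex

variable {n : ℕ} {T : Type*} (K : Triangulation n T)

theorem exists_permute_eq {t t' : T} {a a' : Simplex n} (h : K.proj ⟨t, a⟩ = K.proj ⟨t', a'⟩) :
    ∃ σ, a' = permute σ a := by
  obtain ⟨s, hs⟩ := K.exists_lift_eq h 1
  exact ⟨_, K.lift_eq_permute hs⟩

/-- The points which are closer than `ε` to a point over `x`. -/
def near (x : K.Space) (ε : ℝ) : Set K.Points :=
  {b | ∃ a : Simplex n, K.proj ⟨b.1, a⟩ = x ∧ ∀ j, |b.2.1 j - a.1 j| < ε}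

/-- The number `ε` is small compared with the differences of the barycentric coordinates of the
points over `x`. -/
structure IsSmall (x : K.Space) (ε : ℝ) : Prop where
  pos : 0 < ε
  eq_zero : ∀ {t : T} {a : Simplex n} {j : Fin (n + 1)}, K.proj ⟨t, a⟩ = x → a.1 j < ε → a.1 j = 0
  eq : ∀ {t t' : T} {a a' : Simplex n} {j : Fin (n + 1)}, K.proj ⟨t, a⟩ = x → K.proj ⟨t', a'⟩ = x →
    |a.1 j - a'.1 j| < 2 * ε → a.1 j = a'.1 j

/-- All points over `x` are coordinate permutations of a single one, so only finitely many
coordinate values occur. -/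
theorem exists_isSmall (x : K.Space) : ∃ ε, K.IsSmall x ε := by
  obtain ⟨⟨t, a⟩, rfl⟩ := Quot.exists_rep x
  let V : Set ℝ := insert 0 (Set.range a.1)
  have hV : V.Finite := (Set.finite_range a.1).insert 0
  -- The extra element 1 only makes the set of positive differences nonempty. Half of its minimum
  -- will serve as `ε`.
  let D : Set ℝ := insert 1 ((fun p : ℝ × ℝ => |p.1 - p.2|) '' (V ×ˢ V) \ {0})
  have hD : D.Finite := (((hV.prod hV).image _).sdiff).insert 1
  obtain ⟨d, hd, hmin⟩ := Set.exists_min_image D id hD ⟨1, Set.mem_insert _ _⟩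
  have hd0 : 0 < d := by
    rcases hd with rfl | ⟨⟨p, -, rfl⟩, hp⟩
    · exact one_pos
    · exact lt_of_le_of_ne (abs_nonneg _) (fun h => hp h.symm)
  have key : ∀ v ∈ V, ∀ w ∈ V, |v - w| < d → v = w := by
    intro v hv w hw h
    by_contra hne
    have : |v - w| ∈ D := Or.inr ⟨⟨(v, w), ⟨hv, hw⟩, rfl⟩, by
      simpa [sub_eq_zero] using hne⟩
    exact absurd (hmin _ this) (not_le.2 h)
  have mem : ∀ {t' : T} {a' : Simplex n} (j : Fin (n + 1)), K.proj ⟨t', a'⟩ = K.proj ⟨t, a⟩ →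
      a'.1 j ∈ V := by
    intro t' a' j h
    obtain ⟨σ, rfl⟩ := K.exists_permute_eq h.symm
    exact Or.inr ⟨_, rfl⟩
  refine ⟨d / 2, by positivity, fun {t' a' j} h hj => ?_, fun {t₁ t₂ a₁ a₂ j} h₁ h₂ hj => ?_⟩
  · refine key _ (mem j h) 0 (Or.inl rfl) ?_
    rw [sub_zero, abs_of_nonneg (a'.2.1 j)]
    linarith
  · exact key _ (mem j h₁) _ (mem j h₂) (by linarith)

variable {K}

theorem IsSmall.eq_of_near {x : K.Space} {ε : ℝ} (h : K.IsSmall x ε) {t : T} {a a' b : Simplex n}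
    (ha : K.proj ⟨t, a⟩ = x) (ha' : K.proj ⟨t, a'⟩ = x) (hb : ∀ j, |b.1 j - a.1 j| < ε)
    (hb' : ∀ j, |b.1 j - a'.1 j| < ε) : a = a' := by
  refine Subtype.ext (funext fun j => h.eq ha ha' ?_)
  have h1 := abs_lt.1 (hb j)
  have h2 := abs_lt.1 (hb' j)
  rw [abs_lt]
  constructor <;> linarith

theorem IsSmall.eq_zero_of_near {x : K.Space} {ε : ℝ} (h : K.IsSmall x ε) {t : T} {a b : Simplex n}
    (ha : K.proj ⟨t, a⟩ = x) (hb : ∀ j, |b.1 j - a.1 j| < ε) {j : Fin (n + 1)} (hj : b.1 j = 0) :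
    a.1 j = 0 := by
  refine h.eq_zero ha ?_
  have h1 := hb j
  rw [hj, zero_sub, abs_neg] at h1
  exact (le_abs_self _).trans_lt h1

/-- If `b` lies on a facet, then the corresponding coordinate of the nearby point over `x` is less
than `ε`, hence zero. So both points cross the facet together and stay close. -/
theorem IsSmall.mem_near_of_proj_eq {x : K.Space} {ε : ℝ} (h : K.IsSmall x ε) {b b' : K.Points}
    (hb : b ∈ K.near x ε) (hbb : K.proj b = K.proj b') : b' ∈ K.near x ε := by
  refine K.proj_eq_induction (p := fun b' => b' ∈ K.near x ε) hb ?_ hbb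
  rintro ⟨t, b⟩ i ⟨a, ha, hab⟩ hi
  refine ⟨permute (K.perspectivity (t, i)) a, ?_, fun j => hab _⟩
  rw [← ha]
  exact K.proj_cross t a (h.eq_zero_of_near ha hab hi)

theorem IsSmall.preimage_image_near {x : K.Space} {ε : ℝ} (h : K.IsSmall x ε) :
    K.proj ⁻¹' (K.proj '' K.near x ε) = K.near x ε :=
  Set.Subset.antisymm (fun _ ⟨_, hb, hbb⟩ => h.mem_near_of_proj_eq hb hbb)
    (Set.subset_preimage_image _ _)

theorem isOpen_near (x : K.Space) (ε : ℝ) : IsOpen (K.near x ε) := by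
  rw [isOpen_sigma_iff]
  intro t
  have : Sigma.mk t ⁻¹' K.near x ε = ⋃ a : Simplex n, ⋃ _ : K.proj ⟨t, a⟩ = x,
      ⋂ j, {b : Simplex n | |b.1 j - a.1 j| < ε} := by
    ext b
    simp [near]
  rw [this]
  refine isOpen_iUnion fun a => isOpen_iUnion fun _ => isOpen_iInter_of_finite fun j => ?_
  exact isOpen_lt (((continuous_apply j).comp continuous_subtype_val).sub continuous_const).abs
    continuous_const

theorem IsSmall.isOpen_image_near {x : K.Space} {ε : ℝ} (h : K.IsSmall x ε) :
    IsOpen (K.proj '' K.near x ε) := by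
  have : IsQuotientMap K.proj := isQuotientMap_quot_mk
  rw [← this.isOpen_preimage, h.preimage_image_near]
  exact isOpen_near x ε

theorem IsSmall.mem_near {x : K.Space} {ε : ℝ} (h : K.IsSmall x ε) {t : T} {a : Simplex n}
    (ha : K.proj ⟨t, a⟩ = x) : ⟨t, a⟩ ∈ K.near x ε :=
  ⟨a, ha, fun j => by simpa using h.pos⟩

variable (K)

theorem isOpenMap_forget : IsOpenMap K.forget := by
  intro U hU
  have h1 : IsQuotientMap K.proj := isQuotientMap_quot_mk
  rw [← h1.isOpen_preimage, isOpen_sigma_iff]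
  intro t
  have : Sigma.mk t ⁻¹' (K.proj ⁻¹' (K.forget '' U)) =
      ⋃ s, {a : Simplex n | K.lift t s a ∈ U} := by
    ext a
    simp only [Set.mem_preimage, Set.mem_image, Set.mem_iUnion, Set.mem_ofPred_eq]
    constructor
    · rintro ⟨y, hy, hya⟩
      obtain ⟨t', s, a', rfl⟩ := K.lift_surjective y
      obtain ⟨s', hs'⟩ := K.exists_lift_eq hya s
      exact ⟨s', hs' ▸ hy⟩
    · rintro ⟨s, hs⟩
      exact ⟨_, hs, rfl⟩
  rw [this]
  refine isOpen_iUnion fun s => hU.preimage ?_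
  exact K.cover.continuous_proj.comp continuous_sigmaMk

theorem forget_surjective : Function.Surjective K.forget := by
  intro x
  obtain ⟨⟨t, a⟩, rfl⟩ := Quot.exists_rep x
  exact ⟨K.lift t 1 a, rfl⟩

/-- The map that multiplies the labels by `g⁻¹` on the right. -/
def relabel (g : Equiv.Perm (Fin (n + 1))) : K.cover.Space → K.cover.Space :=
  Quot.lift (fun x => K.lift x.1.1 (x.1.2 * g⁻¹) x.2) fun _ _ h =>
    K.lift_mul_right (Quot.sound h) g⁻¹

theorem relabel_lift (g : Equiv.Perm (Fin (n + 1))) (t : T) (s : Equiv.Perm (Fin (n + 1)))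
    (a : Simplex n) : K.relabel g (K.lift t s a) = K.lift t (s * g⁻¹) a := rfl

theorem continuous_relabel (g : Equiv.Perm (Fin (n + 1))) : Continuous (K.relabel g) := by
  refine continuous_quot_lift _ (K.cover.continuous_proj.comp ?_)
  exact continuous_sigma fun t =>
    continuous_sigmaMk (σ := fun _ : T × Equiv.Perm (Fin (n + 1)) => Simplex n)
      (i := (t.1, t.2 * g⁻¹))

theorem forget_relabel (g : Equiv.Perm (Fin (n + 1))) (x : K.cover.Space) :
    K.forget (K.relabel g x) = K.forget x := by
  obtain ⟨t, s, a, rfl⟩ := K.lift_surjective x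
  rfl

/-- The inverse in `relabel` turns right multiplication of labels into a left action. -/
instance : MulAction (Equiv.Perm (Fin (n + 1))) {x : K.cover.Space // K.IsGood (K.forget x)} where
  smul g x := ⟨K.relabel g x.1, by rw [forget_relabel]; exact x.2⟩
  one_smul x := by
    refine Subtype.ext ?_
    obtain ⟨t, s, a, h⟩ := K.lift_surjective x.1
    change K.relabel 1 x.1 = x.1
    rw [← h, relabel_lift, inv_one, mul_one]
  mul_smul g g' x := by
    refine Subtype.ext ?_
    obtain ⟨t, s, a, h⟩ := K.lift_surjective x.1
    change K.relabel (g * g') x.1 = K.relabel g (K.relabel g' x.1)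
    rw [← h, relabel_lift, relabel_lift, relabel_lift, mul_inv_rev, mul_assoc]

theorem coe_smul (g : Equiv.Perm (Fin (n + 1)))
    (x : {x : K.cover.Space // K.IsGood (K.forget x)}) : (g • x).1 = K.relabel g x.1 := rfl

/-- The map that forgets the labels, over the good points. -/
def goodForget : {x : K.cover.Space // K.IsGood (K.forget x)} → {x : K.Space // K.IsGood x} :=
  Set.restrictPreimage {x | K.IsGood x} K.forget

/-- The fibres are orbits by `exists_lift_eq`. If `g` moves a point of a small neighbourhood of `x`
into that neighbourhood, then the two nearby points over `x` have the same coordinates and labels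
`s` and `s * g⁻¹`, so goodness forces `g = 1`. -/
theorem isQuotientCoveringMap_goodForget :
    IsQuotientCoveringMap K.goodForget (Equiv.Perm (Fin (n + 1))) where
  toIsQuotientMap := ((K.isOpenMap_forget.restrictPreimage _).isQuotientMap
    K.continuous_forget.restrictPreimage
    (Set.restrictPreimage_surjective _ K.forget_surjective))
  continuous_const_smul g :=
    ((K.continuous_relabel g).comp continuous_subtype_val).subtype_mk _
  apply_eq_iff_mem_orbit := by
    rintro ⟨x, hx⟩ ⟨y, hy⟩
    obtain ⟨t, s, a, rfl⟩ := K.lift_surjective x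
    obtain ⟨t', s', a', rfl⟩ := K.lift_surjective y
    constructor
    · intro h
      obtain ⟨u, hu⟩ := K.exists_lift_eq (congrArg Subtype.val h) s
      refine ⟨u⁻¹ * s', Subtype.ext ?_⟩
      refine (K.coe_smul _ _).trans ?_
      rw [relabel_lift, mul_inv_rev, inv_inv, mul_inv_cancel_left]
      exact hu.symm
    · rintro ⟨g, hg⟩
      rw [← hg]
      refine Subtype.ext ?_
      change K.forget (g • (⟨K.lift t' s' a', hy⟩ :
        {x : K.cover.Space // K.IsGood (K.forget x)})).1 = _
      rw [coe_smul, forget_relabel]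
      rfl
  disjoint := by
    rintro ⟨x, hx⟩
    obtain ⟨ε, hε⟩ := K.cover.exists_isSmall x
    refine ⟨Subtype.val ⁻¹' (K.cover.proj '' K.cover.near x ε), ?_, ?_⟩
    · refine (hε.isOpen_image_near.preimage continuous_subtype_val).mem_nhds ?_
      obtain ⟨⟨t, a⟩, rfl⟩ := Quot.exists_rep x
      exact ⟨⟨t, a⟩, hε.mem_near rfl, rfl⟩
    · rintro g ⟨-, ⟨⟨y, hy⟩, hyx, rfl⟩, hgy⟩
      obtain ⟨⟨⟨t, s⟩, b⟩, ⟨a, ha, hab⟩, rfl⟩ := hyx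
      obtain ⟨a', ha', hab'⟩ : (⟨(t, s * g⁻¹), b⟩ : K.cover.Points) ∈ K.cover.near x ε := by
        rw [← hε.preimage_image_near]
        exact hgy
      dsimp only at hab hab' ha ha'
      have haa : a = a' := by
        -- The two points lie in different labelled simplices; this is why `IsSmall.eq` compares
        -- coordinates across simplices.
        refine Subtype.ext (funext fun j => hε.eq ha ha' ?_)
        have h1 := abs_lt.1 (hab j)
        have h2 := abs_lt.1 (hab' j)
        rw [abs_lt]
        constructor <;> linarith
      subst haa
      have := hx t a s (s * g⁻¹) (by rw [← ha]; rfl) (ha.trans ha'.symm)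
      rwa [left_eq_mul, inv_eq_one] at this

/-- Paths in the labelled space that start at the same point and have homotopic images in a
space of good points have the same end point. -/
theorem eq_of_homotopic_forget {Y : Type*} [TopologicalSpace Y] (j : C(Y, K.Space))
    (hj : ∀ y, K.IsGood (j y)) {y z : Y} {γ δ : Path y z} (h : γ.Homotopic δ)
    {u v w : K.cover.Space} (γ' : Path u v) (δ' : Path u w) (hγ : ∀ τ, K.forget (γ' τ) = j (γ τ))
    (hδ : ∀ τ, K.forget (δ' τ) = j (δ τ)) : v = w := by
  have cov := K.isQuotientCoveringMap_goodForget.isCoveringMap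
  let j' : C(Y, {x : K.Space // K.IsGood x}) := ⟨fun y => ⟨j y, hj y⟩, by fun_prop⟩
  let γ₁ : C(unitInterval, {x : K.cover.Space // K.IsGood (K.forget x)}) :=
    ⟨fun τ => ⟨γ' τ, by rw [hγ]; exact hj _⟩, by fun_prop⟩
  let δ₁ : C(unitInterval, {x : K.cover.Space // K.IsGood (K.forget x)}) :=
    ⟨fun τ => ⟨δ' τ, by rw [hδ]; exact hj _⟩, by fun_prop⟩
  have h1 : (γ.map j'.continuous).Homotopic (δ.map j'.continuous) := h.map j'
  let e : {x : K.cover.Space // K.IsGood (K.forget x)} := γ₁ 0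
  have e1 : e = δ₁ 0 := Subtype.ext (γ'.source.trans δ'.source.symm)
  have h2 : ∀ τ, (γ.map j'.continuous) τ = K.goodForget (γ₁ τ) := fun τ =>
    Subtype.ext (hγ τ).symm
  have h3 : ∀ τ, (δ.map j'.continuous) τ = K.goodForget (δ₁ τ) := fun τ =>
    Subtype.ext (hδ τ).symm
  have h4 := cov.liftPath_apply_one_eq_of_homotopicRel h1 e (h2 0) (by rw [e1]; exact h3 0)
  -- By uniqueness of lifts, the given paths are the lifts supplied by the covering.
  rw [← (cov.eq_liftPath_iff' (Γ := γ₁) _).2 ⟨funext fun τ => (h2 τ).symm, rfl⟩,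
    ← (cov.eq_liftPath_iff' (Γ := δ₁) _).2 ⟨funext fun τ => (h3 τ).symm, e1.symm⟩] at h4
  have h5 := congrArg Subtype.val h4
  exact γ'.target.symm.trans (h5.trans δ'.target)

end Triangulation

/-! ### Edge paths, spokes and lifts to the labelled simplices. -/

/-- The simplex without its vertices. -/
def puncturedSimplex (n : ℕ) : Set (Fin (n + 1) → ℝ) :=
  {v | v ∈ stdSimplex ℝ (Fin (n + 1)) ∧ ∀ i, v i < 1}

theorem convex_puncturedSimplex (n : ℕ) : Convex ℝ (puncturedSimplex n) := by
  rintro v ⟨hv, hv'⟩ w ⟨hw, hw'⟩ a b ha hb hab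
  refine ⟨convex_stdSimplex ℝ _ hv hw ha hb hab, fun i => ?_⟩
  change a * v i + b * w i < 1
  rcases ha.eq_or_lt with rfl | ha
  · have h1 : b = 1 := by linarith
    have h2 := hw' i
    rw [h1]
    linarith
  · have h1 := mul_lt_mul_of_pos_left (hv' i) ha
    have h2 := mul_le_mul_of_nonneg_left (hw' i).le hb
    linarith

/-- The straight path between two points of a convex set. -/
def Convex.linePath {E : Type*} [AddCommGroup E] [Module ℝ E] [TopologicalSpace E]
    [ContinuousAdd E] [ContinuousSMul ℝ E] {S : Set E} (hS : Convex ℝ S) (u v : S) : Path u v where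
  toFun τ := ⟨(1 - τ.1) • u.1 + τ.1 • v.1,
    hS u.2 v.2 (by linarith [τ.2.2]) τ.2.1 (by ring)⟩
  continuous_toFun := by fun_prop
  source' := by simp
  target' := by simp

theorem Convex.linePath_apply {E : Type*} [AddCommGroup E] [Module ℝ E] [TopologicalSpace E]
    [ContinuousAdd E] [ContinuousSMul ℝ E] {S : Set E} (hS : Convex ℝ S) (u v : S)
    (τ : unitInterval) : (hS.linePath u v τ).1 = (1 - τ.1) • u.1 + τ.1 • v.1 := rfl

/-- Algebra of a square of path classes with one corner pulled apart. -/
theorem Path.Homotopic.Quotient.trans_eq_of_cast {X : Type*} [TopologicalSpace X]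
    {x x' z z' y y' : X} (hz : z' = z) (hy : y' = y) (A : Path.Homotopic.Quotient x z)
    (B : Path.Homotopic.Quotient x' z') {C : Path.Homotopic.Quotient z y}
    {C' : Path.Homotopic.Quotient z' y'} (hC : C = C'.cast hz.symm hy.symm) :
    A.trans C = (A.trans (B.symm.cast hz.symm rfl)).trans ((B.trans C').cast rfl hy.symm) := by
  subst hz hy hC
  simp only [cast_rfl_rfl, trans_assoc]
  rw [← trans_assoc B.symm, symm_trans, refl_trans]

theorem Path.apply_trans_eq {X Y Z : Type*} [TopologicalSpace X] [TopologicalSpace Y] {g : X → Z}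
    {g' : Y → Z} {x y z : X} {x' y' z' : Y} {p : Path x y} {q : Path y z} {p' : Path x' y'}
    {q' : Path y' z'} (hp : ∀ τ, g (p τ) = g' (p' τ)) (hq : ∀ τ, g (q τ) = g' (q' τ))
    (τ : unitInterval) : g (p.trans q τ) = g' (p'.trans q' τ) := by
  simp only [Path.trans_apply]
  split_ifs
  · exact hp _
  · exact hq _

namespace Triangulation

open Simplex

variable {n : ℕ} {T : Type*} (K : Triangulation n T)

theorem notMem_skeleton_zero_iff {x : K.Points} : x ∉ K.skeleton 0 ↔ ∀ i, x.2.1 i < 1 := by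
  rw [mem_skeleton_zero]
  push Not
  have hs := x.2.2.2
  refine forall_congr' fun i => ?_
  rw [← Finset.add_sum_erase _ _ (Finset.mem_univ i)] at hs
  constructor
  · rintro ⟨j, hj, hx⟩
    have h1 : 0 < x.2.1 j := lt_of_le_of_ne (x.2.2.1 j) hx.symm
    have h2 := Finset.single_le_sum (f := x.2.1) (fun k _ => x.2.2.1 k)
      (Finset.mem_erase.2 ⟨hj, Finset.mem_univ j⟩)
    linarith
  · intro h
    by_contra! hall
    rw [Finset.sum_eq_zero fun j hj => hall j (Finset.ne_of_mem_erase hj)] at hs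
    linarith

theorem barycentre_mem (hn : 3 ≤ n) : (barycentre n).1 ∈ puncturedSimplex n := by
  refine ⟨(barycentre n).2, fun i => ?_⟩
  have : (3 : ℝ) ≤ n := by exact_mod_cast hn
  change 1 / ((n : ℝ) + 1) < 1
  rw [div_lt_one (by positivity)]
  linarith

theorem facetBarycentre_mem (hn : 3 ≤ n) (i : Fin (n + 1)) :
    (facetBarycentre hn i).1 ∈ puncturedSimplex n := by
  refine ⟨(facetBarycentre hn i).2, fun j => ?_⟩
  have : (3 : ℝ) ≤ n := by exact_mod_cast hn
  change (if j = i then 0 else 1 / (n : ℝ)) < 1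
  split_ifs
  · exact one_pos
  · rw [div_lt_one (by positivity)]
    linarith

/-- The barycentre, as a point of the simplex without its vertices. -/
noncomputable def center (hn : 3 ≤ n) : puncturedSimplex n := ⟨_, barycentre_mem hn⟩

/-- The barycentre of a facet, as a point of the simplex without its vertices. -/
noncomputable def facetCenter (hn : 3 ≤ n) (i : Fin (n + 1)) : puncturedSimplex n :=
  ⟨_, facetBarycentre_mem hn i⟩

theorem simplyConnectedSpace_puncturedSimplex (hn : 3 ≤ n) :
    SimplyConnectedSpace (puncturedSimplex n) := by
  have := (convex_puncturedSimplex n).contractibleSpace ⟨_, barycentre_mem hn⟩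
  infer_instance

/-- The quotient map on the simplex `σ_t` without its vertices. -/
def toM (t : T) : C(puncturedSimplex n, K.M) where
  toFun u := ⟨K.proj ⟨t, ⟨u.1, u.2.1⟩⟩, K.proj_notMem (K.notMem_skeleton_zero_iff.2 u.2.2)⟩
  continuous_toFun := by
    refine Continuous.subtype_mk (K.continuous_proj.comp (continuous_sigmaMk.comp ?_)) _
    exact continuous_subtype_val.subtype_mk _

theorem toM_val (t : T) (u : puncturedSimplex n) :
    (K.toM t u).1 = K.proj ⟨t, ⟨u.1, u.2.1⟩⟩ := rfl

theorem exists_toM_eq (y : K.M) : ∃ t u, K.toM t u = y := by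
  obtain ⟨x, hx⟩ := y
  obtain ⟨⟨t, a⟩, rfl⟩ := Quot.exists_rep x
  exact ⟨t, ⟨a.1, a.2, K.notMem_skeleton_zero_iff.1 fun h => hx ⟨_, h, rfl⟩⟩, rfl⟩

theorem toM_center (hn : 3 ≤ n) (t : T) : K.toM t (center hn) = K.dualVertex hn t := rfl

/-- The class of the images of the paths from `u` to `v` in the simplex `σ_t` without its
vertices. -/
def segClass (t : T) (u v : puncturedSimplex n) :
    Path.Homotopic.Quotient (K.toM t u) (K.toM t v) :=
  .mk (((convex_puncturedSimplex n).linePath u v).map (K.toM t).continuous)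

/-- The simplex without its vertices is convex, so the class of a path in it depends only on the
ends. -/
theorem mk_map_toM (hn : 3 ≤ n) (t : T) {u v : puncturedSimplex n} (p : Path u v) :
    Path.Homotopic.Quotient.mk (p.map (K.toM t).continuous) = K.segClass t u v := by
  have := simplyConnectedSpace_puncturedSimplex hn
  exact Path.Homotopic.Quotient.eq.2 ((SimplyConnectedSpace.paths_homotopic p _).map (K.toM t))

theorem segClass_trans (hn : 3 ≤ n) (t : T) (u v w : puncturedSimplex n) :
    (K.segClass t u v).trans (K.segClass t v w) = K.segClass t u w := by
  rw [← K.mk_map_toM hn t (((convex_puncturedSimplex n).linePath u v).trans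
    ((convex_puncturedSimplex n).linePath v w)), Path.map_trans]
  rfl

theorem segClass_self (hn : 3 ≤ n) (t : T) (u : puncturedSimplex n) :
    K.segClass t u u = .refl _ :=
  (K.mk_map_toM hn t (Path.refl u)).symm

/-- The path class from the barycentre of `σ_t` to its point `u`, with image `y` in `M`. -/
noncomputable def spoke (hn : 3 ≤ n) (t : T) (u : puncturedSimplex n) (y : K.M)
    (h : K.toM t u = y) : Path.Homotopic.Quotient (K.dualVertex hn t) y :=
  (K.segClass t (center hn) u).cast (K.toM_center hn t).symm h.symm

theorem spoke_center (hn : 3 ≤ n) (t : T) :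
    K.spoke hn t (center hn) (K.dualVertex hn t) rfl = .refl _ :=
  (Path.Homotopic.Quotient.cast_rfl_rfl _).trans (K.segClass_self hn t _)

theorem permute_facetBarycentre (hn : 3 ≤ n) (σ : Equiv.Perm (Fin (n + 1))) (i : Fin (n + 1)) :
    permute σ (facetBarycentre hn i) = facetBarycentre hn (σ i) := by
  refine Subtype.ext (funext fun j => ?_)
  change (if σ⁻¹ j = i then (0 : ℝ) else _) = if j = σ i then 0 else _
  simp only [Equiv.Perm.inv_eq_iff_eq]

theorem lift_facetBarycentre (hn : 3 ≤ n) (f : Facet n T) (s : Equiv.Perm (Fin (n + 1))) :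
    K.lift (K.partner f).1 (K.perspectivity f * s) (facetBarycentre hn (K.partner f).2) =
      K.lift f.1 s (facetBarycentre hn f.2) := by
  have h : (facetBarycentre hn f.2).1 f.2 = 0 := by simp [facetBarycentre]
  have h2 := K.lift_cross f.1 s (facetBarycentre hn f.2) h
  rw [permute_facetBarycentre, Prod.mk.eta, K.perspectivity_opposite] at h2
  exact h2

/-- The permutation of the vertices by `σ`, on the simplex without its vertices. -/
def permutePunctured (σ : Equiv.Perm (Fin (n + 1))) (u : puncturedSimplex n) :
    puncturedSimplex n :=
  ⟨(permute σ ⟨u.1, u.2.1⟩).1, (permute σ ⟨u.1, u.2.1⟩).2, fun _ => u.2.2 _⟩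

theorem toM_cross (t : T) (u : puncturedSimplex n) {i : Fin (n + 1)} (h : u.1 i = 0) :
    K.toM (K.partner (t, i)).1 (permutePunctured (K.perspectivity (t, i)) u) = K.toM t u :=
  Subtype.ext (K.proj_cross t ⟨u.1, u.2.1⟩ h)

/-- The segment from the barycentre of the facet to `u` stays in the facet, so it has the same image
from both sides. It cuts the region between the two spokes and the dual edge into two triangles,
each inside one simplex. -/
theorem spoke_eq_dualEdge_trans (hn : 3 ≤ n) (f : Facet n T) (u : puncturedSimplex n)
    (h : u.1 f.2 = 0) (y : K.M) (hy : K.toM f.1 u = y)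
    (hy' : K.toM (K.partner f).1 (permutePunctured (K.perspectivity f) u) = y) :
    K.spoke hn f.1 u y hy = (Path.Homotopic.Quotient.mk (K.dualEdge hn f)).trans
      (K.spoke hn (K.partner f).1 (permutePunctured (K.perspectivity f) u) y hy') := by
  subst hy
  have hc : permutePunctured (K.perspectivity f) (facetCenter hn f.2) =
      facetCenter hn (K.partner f).2 := by
    rw [← K.perspectivity_opposite]
    exact Subtype.ext (congrArg (fun a : Simplex n => a.1)
      (permute_facetBarycentre hn (K.perspectivity f) f.2))
  have hC : K.segClass f.1 (facetCenter hn f.2) u =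
      (K.segClass (K.partner f).1 (facetCenter hn (K.partner f).2)
        (permutePunctured (K.perspectivity f) u)).cast (K.facetPoint_partner hn f).symm hy'.symm := by
    refine congrArg Path.Homotopic.Quotient.mk (Path.ext (funext fun τ => ?_))
    have h2 : ((convex_puncturedSimplex n).linePath (facetCenter hn f.2) u τ).1 f.2 = 0 := by
      rw [Convex.linePath_apply]
      simp [facetCenter, facetBarycentre, h]
    refine (K.toM_cross f.1 _ h2).symm.trans ?_
    change _ = K.toM _ ((convex_puncturedSimplex n).linePath _ _ τ)
    rw [← hc]
    rfl
  have := Path.Homotopic.Quotient.trans_eq_of_cast (K.facetPoint_partner hn f) hy'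
    (K.segClass f.1 (center hn) (facetCenter hn f.2))
    (K.segClass (K.partner f).1 (center hn) (facetCenter hn (K.partner f).2)) hC
  refine (K.segClass_trans hn f.1 _ _ _).symm.trans (this.trans ?_)
  exact congrArg (fun C => ((K.segClass f.1 (center hn) (facetCenter hn f.2)).trans
    ((K.segClass (K.partner f).1 (center hn) (facetCenter hn (K.partner f).2)).symm.cast
      (K.facetPoint_partner hn f).symm rfl)).trans (C.cast rfl hy'.symm))
    (K.segClass_trans hn (K.partner f).1 _ _ _)

namespace DualPath

variable {K}

/-- Concatenation of edge paths. -/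
def append : {t t' t'' : T} → K.DualPath t t' → K.DualPath t' t'' → K.DualPath t t''
  | _, _, _, .nil _, δ => δ
  | _, _, _, .cons f rest, δ => .cons f (rest.append δ)

theorem projectivity_append {t t' t'' : T} (γ : K.DualPath t t') (δ : K.DualPath t' t'') :
    (γ.append δ).projectivity = δ.projectivity * γ.projectivity := by
  induction γ with
  | nil => rfl
  | cons f rest ih => exact (congrArg (· * K.perspectivity f) (ih δ)).trans (mul_assoc _ _ _)

theorem mk_toPath_append (hn : 3 ≤ n) {t t' t'' : T} (γ : K.DualPath t t')
    (δ : K.DualPath t' t'') :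
    Path.Homotopic.Quotient.mk ((γ.append δ).toPath hn) =
      (Path.Homotopic.Quotient.mk (γ.toPath hn)).trans (.mk (δ.toPath hn)) := by
  induction γ with
  | nil => exact (Path.Homotopic.Quotient.refl_trans _).symm
  | cons f rest ih =>
    have h := congrArg (Path.Homotopic.Quotient.trans (.mk (K.dualEdge hn f))) (ih δ)
    rw [← Path.Homotopic.Quotient.trans_assoc] at h
    exact h

/-- The edge path that crosses a single facet. -/
def single (f : Facet n T) : K.DualPath f.1 (K.partner f).1 := .cons f (.nil _)

theorem projectivity_single (f : Facet n T) :
    (single (K := K) f).projectivity = K.perspectivity f := one_mul _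

theorem mk_toPath_single (hn : 3 ≤ n) (f : Facet n T) :
    Path.Homotopic.Quotient.mk ((single (K := K) f).toPath hn) =
      .mk (K.dualEdge hn f) :=
  Path.Homotopic.Quotient.trans_refl (.mk (K.dualEdge hn f))

/-- An edge path lifts to the labelled simplices, and the lift multiplies the labels by the
projectivity. -/
theorem exists_lift (hn : 3 ≤ n) {t t' : T} (γ : K.DualPath t t')
    (s : Equiv.Perm (Fin (n + 1))) :
    ∃ Γ : Path (K.lift t s (barycentre n)) (K.lift t' (γ.projectivity * s) (barycentre n)),
      ∀ τ, K.forget (Γ τ) = (γ.toPath hn τ).1 := by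
  induction γ generalizing s with
  | nil => exact ⟨(Path.refl _).cast rfl (by rw [projectivity, one_mul]), fun τ => rfl⟩
  | cons f rest ih =>
    obtain ⟨Γ, hΓ⟩ := ih (K.perspectivity f * s)
    have half : ∀ (g : Facet n T) (r : Equiv.Perm (Fin (n + 1))),
        ∃ H : Path (K.lift g.1 r (barycentre n)) (K.lift g.1 r (facetBarycentre hn g.2)),
          ∀ τ, K.forget (H τ) = (K.halfEdge hn g τ).1 := fun g r =>
      ⟨{ toFun := fun τ => K.lift g.1 r (segmentPoint hn g.2 τ)
         continuous_toFun := K.cover.continuous_proj.comp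
          (continuous_sigmaMk.comp (continuous_segmentPoint hn g.2))
         source' := by rw [segmentPoint_zero]
         target' := by rw [segmentPoint_one] }, fun τ => rfl⟩
    obtain ⟨H₁, h₁⟩ := half f s
    obtain ⟨H₂, h₂⟩ := half (K.partner f) (K.perspectivity f * s)
    -- The two half edges meet because the label of the second simplex is the perspectivity times
    -- `s`.
    let H := (H₁.trans (H₂.symm.cast (K.lift_facetBarycentre hn f s).symm rfl)).trans Γ
    refine ⟨H.cast rfl (by rw [projectivity, mul_assoc]), fun τ => ?_⟩
    exact Path.apply_trans_eq (g := K.forget) (g' := Subtype.val) (q' := rest.toPath hn)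
      (Path.apply_trans_eq h₁ fun τ => h₂ _) hΓ τ

end DualPath

/-- The facets crossed by the chain of gluings form the edge path. All of them contain the point, so
the path can be shrunk along spokes, one crossing at a time. -/
theorem exists_dualPath_of_lift_eq (hn : 3 ≤ n) {t t' : T} {s s' : Equiv.Perm (Fin (n + 1))}
    {a a' : Simplex n} (ha : a.1 ∈ puncturedSimplex n) (h : K.lift t s a = K.lift t' s' a') :
    ∃ (ha' : a'.1 ∈ puncturedSimplex n) (δ : K.DualPath t t'), δ.projectivity * s = s' ∧
      ∀ (y : K.M) (hy : K.toM t ⟨a.1, ha⟩ = y) (hy' : K.toM t' ⟨a'.1, ha'⟩ = y),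
        K.spoke hn t ⟨a.1, ha⟩ y hy = (Path.Homotopic.Quotient.mk (δ.toPath hn)).trans
          (K.spoke hn t' ⟨a'.1, ha'⟩ y hy') := by
  refine K.lift_eq_induction (t := t) (s := s) (a := a) (p := fun t' s' a' =>
    ∃ (ha' : a'.1 ∈ puncturedSimplex n) (δ : K.DualPath t t'), δ.projectivity * s = s' ∧
      ∀ (y : K.M) (hy : K.toM t ⟨a.1, ha⟩ = y) (hy' : K.toM t' ⟨a'.1, ha'⟩ = y),
        K.spoke hn t ⟨a.1, ha⟩ y hy = (Path.Homotopic.Quotient.mk (δ.toPath hn)).trans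
          (K.spoke hn t' ⟨a'.1, ha'⟩ y hy')) ?_ ?_ h
  · exact ⟨ha, .nil t, one_mul s, fun y hy hy' => (Path.Homotopic.Quotient.refl_trans _).symm⟩
  · rintro t' s' a' i ⟨ha', δ, hδ, hspoke⟩ hi
    refine ⟨(permutePunctured (K.perspectivity (t', i)) ⟨a'.1, ha'⟩).2,
      δ.append (.single (t', i)), ?_, fun y hy hy' => ?_⟩
    · rw [DualPath.projectivity_append, DualPath.projectivity_single, mul_assoc, hδ]
    · have hy'' : K.toM t' ⟨a'.1, ha'⟩ = y := (K.toM_cross t' ⟨a'.1, ha'⟩ hi).symm.trans hy'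
      rw [hspoke y hy hy'', K.spoke_eq_dualEdge_trans hn (t', i) ⟨a'.1, ha'⟩ hi y hy'' hy',
        DualPath.mk_toPath_append, DualPath.mk_toPath_single,
        Path.Homotopic.Quotient.trans_assoc]
      rfl

end Triangulation

/-! ### Radial contractions; every path class comes from an edge path. -/

/-- The sides of a square with one side collapsed to a point. -/
theorem Path.Homotopic.Quotient.mk_trans_eq_of_square {X : Type*} [TopologicalSpace X]
    (Q : C(unitInterval × unitInterval, X)) {x y z : X} (α : Path y z) (β : Path y x)
    (γ : Path z x) (hα : ∀ s, Q (s, 0) = α s) (hβ : ∀ τ, Q (0, τ) = β τ)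
    (hγ : ∀ τ, Q (1, τ) = γ τ) (hx : ∀ s, Q (s, 1) = x) :
    (Quotient.mk α).trans (.mk γ) = .mk β := by
  obtain rfl : Q (0, 0) = y := (hα 0).trans α.source
  obtain rfl : Q (1, 0) = z := (hα 1).trans α.target
  obtain rfl : Q (1, 1) = x := hx 1
  let bottom : Path ((0, 0) : unitInterval × unitInterval) (1, 0) :=
    ⟨⟨fun s => (s, 0), by fun_prop⟩, rfl, rfl⟩
  let right : Path ((1, 0) : unitInterval × unitInterval) (1, 1) :=
    ⟨⟨fun τ => (1, τ), by fun_prop⟩, rfl, rfl⟩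
  let left : Path ((0, 0) : unitInterval × unitInterval) (0, 1) :=
    ⟨⟨fun τ => (0, τ), by fun_prop⟩, rfl, rfl⟩
  let top : Path ((0, 1) : unitInterval × unitInterval) (1, 1) :=
    ⟨⟨fun s => (s, 1), by fun_prop⟩, rfl, rfl⟩
  have : ContractibleSpace unitInterval :=
    (convex_Icc (0 : ℝ) 1).contractibleSpace ⟨0, by simp⟩
  have h := (SimplyConnectedSpace.paths_homotopic (bottom.trans right) (left.trans top)).map Q
  rw [Path.map_trans, Path.map_trans] at h
  have h' := Quotient.eq.2 h
  rw [mk_trans, mk_trans] at h'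
  have e1 : bottom.map Q.continuous = α := Path.ext (funext hα)
  have e2 : right.map Q.continuous = γ := Path.ext (funext hγ)
  have e3 : left.map Q.continuous = β.cast rfl (hx 0) := Path.ext (funext hβ)
  have e4 : top.map Q.continuous = (Path.refl (Q (1, 1))).cast (hx 0) rfl :=
    Path.ext (funext hx)
  rw [e1, e2, e3, e4] at h'
  rw [h']
  have : ∀ {a b c : X} (p : Path a b) (hc : c = b),
      (Quotient.mk (p.cast rfl hc)).trans (.mk ((Path.refl b).cast hc rfl)) = .mk p := by
    rintro a b c p rfl
    exact trans_refl _
  exact this β (hx 0)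

/-- The point at time `τ` on the straight segment from `b` to `a`. -/
def Simplex.segment {n : ℕ} (b a : Simplex n) (τ : unitInterval) : Simplex n :=
  ⟨(1 - τ.1) • b.1 + τ.1 • a.1, convex_stdSimplex ℝ _ b.2 a.2 (by linarith [τ.2.2]) τ.2.1 (by ring)⟩

theorem Simplex.permute_segment {n : ℕ} (σ : Equiv.Perm (Fin (n + 1))) (b a : Simplex n)
    (τ : unitInterval) :
    permute σ (segment b a τ) = segment (permute σ b) (permute σ a) τ := rfl

namespace Triangulation

open Simplex

variable {n : ℕ} {T : Type*} (K : Triangulation n T)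

open Classical in
/-- A point over `x` in the same simplex that is closer to `b` than `ε`, if there is one. -/
noncomputable def nearest (x : K.Space) (ε : ℝ) (b : K.Points) : Simplex n :=
  if h : b ∈ K.near x ε then h.choose else b.2

variable {K}

theorem proj_nearest {x : K.Space} {ε : ℝ} {b : K.Points} (h : b ∈ K.near x ε) :
    K.proj ⟨b.1, K.nearest x ε b⟩ = x := by
  rw [nearest, dif_pos h]
  exact h.choose_spec.1

theorem abs_sub_nearest_lt {x : K.Space} {ε : ℝ} {b : K.Points} (h : b ∈ K.near x ε)
    (j : Fin (n + 1)) : |b.2.1 j - (K.nearest x ε b).1 j| < ε := by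
  rw [nearest, dif_pos h]
  exact h.choose_spec.2 j

theorem IsSmall.nearest_eq {x : K.Space} {ε : ℝ} (h : K.IsSmall x ε) {t : T} {a b : Simplex n}
    (ha : K.proj ⟨t, a⟩ = x) (hb : ∀ j, |b.1 j - a.1 j| < ε) : K.nearest x ε ⟨t, b⟩ = a :=
  have hn : (⟨t, b⟩ : K.Points) ∈ K.near x ε := ⟨a, ha, hb⟩
  h.eq_of_near (proj_nearest hn) ha (abs_sub_nearest_lt hn) hb

/-- When `b` lies on a facet, so does the nearest point over `x`, hence the whole segment between
them; radial segments are therefore compatible with the gluing. -/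
theorem IsSmall.proj_segment_nearest {x : K.Space} {ε : ℝ} (h : K.IsSmall x ε) {b b' : K.Points}
    (hb : b ∈ K.near x ε) (hbb : K.proj b = K.proj b') (τ : unitInterval) :
    K.proj ⟨b.1, segment b.2 (K.nearest x ε b) τ⟩ =
      K.proj ⟨b'.1, segment b'.2 (K.nearest x ε b') τ⟩ := by
  refine (K.proj_eq_induction (p := fun b' => b' ∈ K.near x ε ∧
    K.proj ⟨b.1, segment b.2 (K.nearest x ε b) τ⟩ =
      K.proj ⟨b'.1, segment b'.2 (K.nearest x ε b') τ⟩) ⟨hb, rfl⟩ ?_ hbb).2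
  rintro ⟨t, b⟩ i ⟨hb, he⟩ hi
  have ha := proj_nearest hb
  have hab := abs_sub_nearest_lt hb
  have ha0 := h.eq_zero_of_near ha hab hi
  refine ⟨h.mem_near_of_proj_eq hb (K.proj_cross t b hi).symm, he.trans ?_⟩
  dsimp only at ha0 ha hab hi ⊢
  rw [h.nearest_eq (a := permute (K.perspectivity (t, i)) (K.nearest x ε ⟨t, b⟩))
    ((K.proj_cross t _ ha0).trans ha) (fun j => hab _), ← Simplex.permute_segment, K.proj_cross]
  change (1 - τ.1) * b.1 i + τ.1 * (K.nearest x ε ⟨t, b⟩).1 i = 0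
  rw [hi, ha0, mul_zero, mul_zero, add_zero]

theorem IsSmall.mem_puncturedSimplex {x : K.M} {ε : ℝ} (h : K.IsSmall x.1 ε) {b : K.Points}
    (hb : b ∈ K.near x.1 ε) : b.2.1 ∈ puncturedSimplex n ∧
      (K.nearest x.1 ε b).1 ∈ puncturedSimplex n := by
  have ha := proj_nearest hb
  have h1 : (⟨b.1, K.nearest x.1 ε b⟩ : K.Points) ∉ K.skeleton 0 := fun hm =>
    x.2 ⟨_, hm, ha⟩
  refine ⟨⟨b.2.2, K.notMem_skeleton_zero_iff.1 fun hm => h1 ?_⟩,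
    (K.nearest x.1 ε b).2, K.notMem_skeleton_zero_iff.1 h1⟩
  rw [mem_skeleton_zero] at hm ⊢
  obtain ⟨i, hi⟩ := hm
  exact ⟨i, fun j hj => h.eq_zero_of_near ha (abs_sub_nearest_lt hb) (hi j hj)⟩

/-- The nearest point over `x` is locally constant. -/
theorem IsSmall.continuous_segment_nearest {x : K.Space} {ε : ℝ} (h : K.IsSmall x ε) :
    Continuous fun p : {b : K.Points // b ∈ K.near x ε} × unitInterval =>
      (⟨p.1.1.1, segment p.1.1.2 (K.nearest x ε p.1.1) p.2⟩ : K.Points) := by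
  rw [continuous_iff_continuousAt]
  rintro ⟨⟨⟨t, b⟩, hb⟩, τ⟩
  obtain ⟨a, ha, hab⟩ := hb
  have hcont : Continuous fun p : K.Points × unitInterval =>
      (⟨p.1.1, segment p.1.2 a p.2⟩ : K.Points) := by
    have hs : Continuous fun q : Simplex n × unitInterval => segment q.1 a q.2 := by
      refine Continuous.subtype_mk ?_ _
      have : Continuous fun q : Simplex n × unitInterval => q.1.1 :=
        continuous_subtype_val.comp continuous_fst
      fun_prop
    exact (Continuous.sigma_map (σ := fun _ : T => Simplex n × unitInterval)
      (τ := fun _ : T => Simplex n) (f₁ := id) (f₂ := fun _ q => segment q.1 a q.2)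
      fun _ => hs).comp Homeomorph.sigmaProdDistrib.continuous
  refine ((hcont.comp (continuous_subtype_val.prodMap continuous_id)).continuousAt).congr ?_
  have hopen : IsOpen (Sigma.mk t '' {b : Simplex n | ∀ j, |b.1 j - a.1 j| < ε} : Set K.Points) := by
    refine isOpenMap_sigmaMk _ ?_
    have : {b : Simplex n | ∀ j, |b.1 j - a.1 j| < ε} =
        ⋂ j, {b : Simplex n | |b.1 j - a.1 j| < ε} := by
      ext; simp
    rw [this]
    exact isOpen_iInter_of_finite fun j => isOpen_lt
      (((continuous_apply j).comp continuous_subtype_val).sub continuous_const).abs continuous_const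
  have hmem : ((fun p : {b : K.Points // b ∈ K.near x ε} × unitInterval => p.1.1) ⁻¹'
      (Sigma.mk t '' {b : Simplex n | ∀ j, |b.1 j - a.1 j| < ε})) ∈
      𝓝 ((⟨⟨t, b⟩, ⟨a, ha, hab⟩⟩, τ) : {b : K.Points // b ∈ K.near x ε} × unitInterval) :=
    (hopen.preimage (continuous_subtype_val.comp continuous_fst)).mem_nhds ⟨b, hab, rfl⟩
  filter_upwards [hmem]
  rintro ⟨⟨c, hc⟩, τ'⟩ ⟨b', hb', rfl⟩
  simp only [Function.comp_apply, Prod.map_apply, id_eq]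
  rw [h.nearest_eq ha hb']

/-- The radial contraction of a small neighbourhood of a point `x` of `M` to `x`. -/
theorem IsSmall.exists_contraction {x : K.M} {ε : ℝ} (h : K.IsSmall x.1 ε) :
    ∃ G : C({y : K.Space // y ∈ K.proj '' K.near x.1 ε} × unitInterval, K.M),
      ∀ (b : K.Points) (hb : b ∈ K.near x.1 ε) (τ : unitInterval),
        G (⟨K.proj b, b, hb, rfl⟩, τ) = K.toM b.1 ((convex_puncturedSimplex n).linePath
          ⟨b.2.1, (h.mem_puncturedSimplex hb).1⟩
          ⟨(K.nearest x.1 ε b).1, (h.mem_puncturedSimplex hb).2⟩ τ) := by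
  let N := {y : K.Space // y ∈ K.proj '' K.near x.1 ε}
  let g : N × unitInterval → K.M := fun p => K.toM p.1.2.choose.1
    ((convex_puncturedSimplex n).linePath
      ⟨p.1.2.choose.2.1, (h.mem_puncturedSimplex p.1.2.choose_spec.1).1⟩
      ⟨(K.nearest x.1 ε p.1.2.choose).1, (h.mem_puncturedSimplex p.1.2.choose_spec.1).2⟩ p.2)
  have hg : ∀ (b : K.Points) (hb : b ∈ K.near x.1 ε) (τ : unitInterval),
      g (⟨K.proj b, b, hb, rfl⟩, τ) = K.toM b.1 ((convex_puncturedSimplex n).linePath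
        ⟨b.2.1, (h.mem_puncturedSimplex hb).1⟩
        ⟨(K.nearest x.1 ε b).1, (h.mem_puncturedSimplex hb).2⟩ τ) := by
    intro b hb τ
    have hc : ∃ b', b' ∈ K.near x.1 ε ∧ K.proj b' = K.proj b := ⟨b, hb, rfl⟩
    exact Subtype.ext (h.proj_segment_nearest hc.choose_spec.1 hc.choose_spec.2 τ)
  refine ⟨⟨g, ?_⟩, hg⟩
  have hq : IsQuotientMap K.proj := isQuotientMap_quot_mk
  -- Continuity may be tested before gluing, since a quotient map stays one after taking the product
  -- with the unit interval.
  refine (hq.restrictPreimage_isOpen h.isOpen_image_near).continuous_lift_prod_left ?_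
  have hb : ∀ b : K.proj ⁻¹' (K.proj '' K.near x.1 ε), b.1 ∈ K.near x.1 ε :=
    fun b => h.preimage_image_near.subset b.2
  have h1 : (fun p : (K.proj ⁻¹' (K.proj '' K.near x.1 ε)) × unitInterval =>
      g ((K.proj '' K.near x.1 ε).restrictPreimage K.proj p.1, p.2)) = fun p =>
      K.toM p.1.1.1 ((convex_puncturedSimplex n).linePath
        ⟨p.1.1.2.1, (h.mem_puncturedSimplex (hb p.1)).1⟩
        ⟨(K.nearest x.1 ε p.1.1).1, (h.mem_puncturedSimplex (hb p.1)).2⟩ p.2) :=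
    funext fun p => hg p.1.1 (hb p.1) p.2
  rw [h1]
  refine Continuous.subtype_mk (K.continuous_proj.comp ?_) _
  have h2 : Continuous fun p : (K.proj ⁻¹' (K.proj '' K.near x.1 ε)) × unitInterval =>
      ((⟨p.1.1, hb p.1⟩, p.2) : {b : K.Points // b ∈ K.near x.1 ε} × unitInterval) := by
    fun_prop
  exact h.continuous_segment_nearest.comp h2

variable (K)

/-- A path class in `M` is, up to spokes at both ends, a class of edge paths. -/
def IsDual (hn : 3 ≤ n) {y z : K.M} (q : Path.Homotopic.Quotient y z) : Prop :=
  ∀ t u t' u' (h : K.toM t u = y) (h' : K.toM t' u' = z), ∃ δ : K.DualPath t t',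
    (K.spoke hn t u y h).trans q =
      (Path.Homotopic.Quotient.mk (δ.toPath hn)).trans (K.spoke hn t' u' z h')

variable {K}

theorem IsDual.trans {hn : 3 ≤ n} {x y z : K.M} {p : Path.Homotopic.Quotient x y}
    {q : Path.Homotopic.Quotient y z} (hp : K.IsDual hn p) (hq : K.IsDual hn q) :
    K.IsDual hn (p.trans q) := by
  intro t u t'' u'' h h''
  obtain ⟨t', u', h'⟩ := K.exists_toM_eq y
  obtain ⟨δ, hδ⟩ := hp t u t' u' h h'
  obtain ⟨δ', hδ'⟩ := hq t' u' t'' u'' h' h''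
  refine ⟨δ.append δ', ?_⟩
  rw [← Path.Homotopic.Quotient.trans_assoc, hδ, Path.Homotopic.Quotient.trans_assoc, hδ',
    DualPath.mk_toPath_append, Path.Homotopic.Quotient.trans_assoc]

theorem spoke_trans_mk (hn : 3 ≤ n) (t : T) (u v : puncturedSimplex n) {y x : K.M}
    (hy : K.toM t u = y) (hx : K.toM t v = x) (β : Path y x)
    (hβ : ∀ τ, β τ = K.toM t ((convex_puncturedSimplex n).linePath u v τ)) :
    (K.spoke hn t u y hy).trans (.mk β) = K.spoke hn t v x hx := by
  subst hy hx
  have : β = ((convex_puncturedSimplex n).linePath u v).map (K.toM t).continuous :=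
    Path.ext (funext hβ)
  rw [this]
  exact K.segClass_trans hn t (center hn) u v

theorem spoke_eq_of_same_image (hn : 3 ≤ n) {t t' : T} {u u' : puncturedSimplex n} {y : K.M}
    (h : K.toM t u = y) (h' : K.toM t' u' = y) : ∃ δ : K.DualPath t t',
    K.spoke hn t u y h =
      (Path.Homotopic.Quotient.mk (δ.toPath hn)).trans (K.spoke hn t' u' y h') := by
  obtain ⟨s', hs'⟩ := K.exists_lift_eq (congrArg Subtype.val (h.trans h'.symm)) 1
  obtain ⟨ha', δ, -, hδ⟩ := K.exists_dualPath_of_lift_eq hn u.2 hs'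
  exact ⟨δ, hδ y h h'⟩

/-- The radial contraction sweeps a square that deforms `α` into a path to `x` and back. Each of the
two radial sides lies in one simplex and is absorbed by a spoke; the resulting spokes to `x` differ
by an edge path. -/
theorem IsSmall.isDual {hn : 3 ≤ n} {x : K.M} {ε : ℝ} (h : K.IsSmall x.1 ε) {y z : K.M}
    (α : Path y z) (hα : ∀ s, (α s).1 ∈ K.proj '' K.near x.1 ε) : K.IsDual hn (.mk α) := by
  intro t u t' u' hu hu'
  obtain ⟨G, hG⟩ := h.exists_contraction
  have hmem : ∀ {t : T} {u : puncturedSimplex n} {s : unitInterval}, K.toM t u = α s →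
      (⟨t, ⟨u.1, u.2.1⟩⟩ : K.Points) ∈ K.near x.1 ε := by
    intro t u s hs
    have := hα s
    rw [← hs] at this
    rw [← h.preimage_image_near]
    exact this
  let Q : C(unitInterval × unitInterval, K.M) := ⟨fun p => G (⟨(α p.1).1, hα p.1⟩, p.2), by
    refine G.continuous.comp (Continuous.prodMk (Continuous.subtype_mk ?_ _) continuous_snd)
    exact continuous_subtype_val.comp (α.continuous.comp continuous_fst)⟩
  have hQ : ∀ {t : T} {u : puncturedSimplex n} {s : unitInterval} (hs : K.toM t u = α s)
      (τ : unitInterval), Q (s, τ) = K.toM t ((convex_puncturedSimplex n).linePath u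
        ⟨_, (h.mem_puncturedSimplex (hmem hs)).2⟩ τ) := by
    intro t u s hs τ
    have h1 := hG _ (hmem hs) τ
    rw [← h1]
    have h2 : (α s).1 = K.proj ⟨t, ⟨u.1, u.2.1⟩⟩ := congrArg Subtype.val hs.symm
    exact congrArg G (Prod.ext (Subtype.ext h2) rfl)
  have hend : ∀ {t : T} {u : puncturedSimplex n} {s : unitInterval} (hs : K.toM t u = α s),
      K.toM t ⟨_, (h.mem_puncturedSimplex (hmem hs)).2⟩ = x := fun hs =>
    Subtype.ext (proj_nearest (hmem hs))
  have h0 : ∀ s, Q (s, 0) = α s := by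
    intro s
    obtain ⟨t, u, hs⟩ := K.exists_toM_eq (α s)
    rw [hQ hs, Path.source, hs]
  have h1 : ∀ s, Q (s, 1) = x := by
    intro s
    obtain ⟨t, u, hs⟩ := K.exists_toM_eq (α s)
    rw [hQ hs, Path.target]
    exact hend hs
  let side : ∀ s, Path (α s) x := fun s => ⟨⟨fun τ => Q (s, τ), by fun_prop⟩, h0 s, h1 s⟩
  have key := Path.Homotopic.Quotient.mk_trans_eq_of_square Q α
    ((side 0).cast α.source.symm rfl) ((side 1).cast α.target.symm rfl) h0
    (fun _ => rfl) (fun _ => rfl) h1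
  have hs0 := hu.trans α.source.symm
  have hs1 := hu'.trans α.target.symm
  have e0 := spoke_trans_mk hn t u _ hu (hend hs0) ((side 0).cast α.source.symm rfl)
    (fun τ => hQ hs0 τ)
  have e1 := spoke_trans_mk hn t' u' _ hu' (hend hs1) ((side 1).cast α.target.symm rfl)
    (fun τ => hQ hs1 τ)
  obtain ⟨δ, hδ⟩ := spoke_eq_of_same_image hn (hend hs0) (hend hs1)
  refine ⟨δ, ?_⟩
  rw [← key, hδ, ← e1, ← Path.Homotopic.Quotient.trans_assoc,
    ← Path.Homotopic.Quotient.trans_assoc] at e0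
  have e2 := congrArg (fun q => q.trans
    (Path.Homotopic.Quotient.mk ((side 1).cast α.target.symm rfl)).symm) e0
  simpa only [Path.Homotopic.Quotient.trans_assoc, Path.Homotopic.Quotient.trans_symm,
    Path.Homotopic.Quotient.trans_refl] using e2

/-- Compactness of the interval cuts the path into pieces that each lie in one small neighbourhood.
-/
theorem isDual_mk (hn : 3 ≤ n) {y z : K.M} (α : Path y z) : K.IsDual hn (.mk α) := by
  choose ε hε using fun x : K.M => K.exists_isSmall x.1
  obtain ⟨τ, hτ0, hτmono, ⟨m, hm⟩, hτ⟩ := exists_monotone_Icc_subset_open_cover_unitInterval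
    (c := fun x : K.M => {s | (α s).1 ∈ K.proj '' K.near x.1 (ε x)})
    (fun x => (hε x).isOpen_image_near.preimage (continuous_subtype_val.comp α.continuous))
    (fun s _ => by
      refine Set.mem_iUnion.2 ⟨α s, ?_⟩
      obtain ⟨t, u, hu⟩ := K.exists_toM_eq (α s)
      exact ⟨⟨t, ⟨u.1, u.2.1⟩⟩, (hε (α s)).mem_near (congrArg Subtype.val hu),
        congrArg Subtype.val hu⟩)
  have local_isDual : ∀ k, K.IsDual hn (.mk (α.subpath (τ k) (τ (k + 1)))) := by
    intro k
    obtain ⟨x, hx⟩ := hτ k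
    refine (hε x).isDual _ fun s => ?_
    have : α.subpath (τ k) (τ (k + 1)) s ∈ α '' Set.Icc (τ k) (τ (k + 1)) := by
      rw [← Path.range_subpath_of_le _ _ _ (hτmono k.le_succ)]
      exact ⟨s, rfl⟩
    obtain ⟨r, hr, hrs⟩ := this
    rw [← hrs]
    exact hx hr
  have hall : ∀ k, K.IsDual hn (.mk (α.subpath 0 (τ k))) := by
    intro k
    induction k with
    | zero =>
      rw [hτ0, Path.subpath_self]
      intro t u t' u' h h'
      rw [Path.Homotopic.Quotient.mk_refl, Path.Homotopic.Quotient.trans_refl]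
      exact spoke_eq_of_same_image hn h h'
    | succ k ih =>
      have := ih.trans (local_isDual k)
      rwa [← Path.Homotopic.Quotient.mk_trans,
        Path.Homotopic.Quotient.eq.2 ⟨Path.Homotopy.subpathTransSubpath α _ _ _⟩] at this
  have h := hall m
  rw [hm m le_rfl, Path.subpath_zero_one] at h
  intro t u t' u' hu hu'
  obtain ⟨δ, hδ⟩ := h t u t' u' (hu.trans α.source.symm) (hu'.trans α.target.symm)
  refine ⟨δ, ?_⟩
  have : ∀ {y' z' : K.M} (hy : y' = y) (hz : z' = z) (hu : K.toM t u = y) (hu' : K.toM t' u' = z)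
      (_ : (K.spoke hn t u y' (hu.trans hy.symm)).trans (.mk (α.cast hy hz)) =
        (Path.Homotopic.Quotient.mk (δ.toPath hn)).trans
          (K.spoke hn t' u' z' (hu'.trans hz.symm))),
      (K.spoke hn t u y hu).trans (.mk α) =
        (Path.Homotopic.Quotient.mk (δ.toPath hn)).trans (K.spoke hn t' u' z hu') := by
    rintro _ _ rfl rfl _ _ h
    exact h
  exact this α.source α.target hu hu' hδ

/-- Every class of paths between barycentres is the class of an edge path. -/
theorem exists_dualPath_eq (hn : 3 ≤ n) {t t' : T}
    (q : Path.Homotopic.Quotient (K.dualVertex hn t) (K.dualVertex hn t')) :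
    ∃ δ : K.DualPath t t', Path.Homotopic.Quotient.mk (δ.toPath hn) = q := by
  obtain ⟨α, rfl⟩ := Path.Homotopic.Quotient.mk_surjective q
  obtain ⟨δ, hδ⟩ := isDual_mk hn α t (center hn) t' (center hn) rfl rfl
  refine ⟨δ, ?_⟩
  rw [spoke_center, spoke_center, Path.Homotopic.Quotient.refl_trans,
    Path.Homotopic.Quotient.trans_refl] at hδ
  exact hδ.symm

end Triangulation

/-! ### Rotation around codimension two faces, and their degrees. -/

/-- If `r` and `c` are fixed-point-free involutions, then `r` maps no point to the orbit of this
point under `r * c`. -/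
theorem Equiv.Perm.zpow_mul_apply_ne_of_involutions {X : Type*} {r c : Equiv.Perm X}
    (hr : r * r = 1) (hc : c * c = 1) (hr' : ∀ x, r x ≠ x) (hc' : ∀ x, c x ≠ x) (k : ℤ) (x : X) :
    ((r * c) ^ k) x ≠ r x := by
  have hr1 : r⁻¹ = r := inv_eq_of_mul_eq_one_left hr
  have hc1 : c⁻¹ = c := inv_eq_of_mul_eq_one_left hc
  have hconj : ∀ m : ℤ, r * (r * c) ^ m = (r * c) ^ (-m) * r := by
    intro m
    have h1 : r * (r * c) * r⁻¹ = (r * c)⁻¹ := by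
      rw [mul_inv_rev, hr1, hc1, ← mul_assoc, hr, one_mul]
    have h2 := conj_zpow (a := r) (b := r * c) (i := m)
    rw [h1, inv_zpow', eq_mul_inv_iff_mul_eq] at h2
    exact h2.symm
  intro h
  -- In the dihedral group, `r * (r * c) ^ k` is a conjugate of `r` for even `k` and of `c` for odd
  -- `k`. A fixed point of it gives one of `r` or `c`, at the halfway point of the rotation.
  rcases Int.even_or_odd' k with ⟨m, rfl | rfl⟩
  · refine hr' (((r * c) ^ m) x) ?_
    rw [← Equiv.Perm.mul_apply, hconj, Equiv.Perm.mul_apply, ← h, ← Equiv.Perm.mul_apply,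
      ← zpow_add]
    congr 2
    ring
  · refine hc' (((r * c) ^ m) x) (r.injective ?_)
    have h2 : r (((r * c) ^ m) x) = ((r * c) ^ (m + 1)) x := by
      rw [← Equiv.Perm.mul_apply, hconj, Equiv.Perm.mul_apply, ← h, ← Equiv.Perm.mul_apply,
        ← zpow_add]
      congr 2
      ring
    rw [h2, ← Equiv.Perm.mul_apply, ← Equiv.Perm.mul_apply, add_comm, zpow_add, zpow_one]

theorem Equiv.Perm.apply_zpow_eq {X Y : Type*} {g : Equiv.Perm X} {g' : Equiv.Perm Y} {f : X → Y}
    (h : ∀ x, f (g x) = g' (f x)) (k : ℤ) (x : X) : f ((g ^ k) x) = (g' ^ k) (f x) := by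
  have hn : ∀ (m : ℕ) (x : X), f ((g ^ m) x) = (g' ^ m) (f x) := by
    intro m
    induction m with
    | zero => exact fun _ => rfl
    | succ m ih =>
      intro x
      rw [pow_succ', pow_succ', Equiv.Perm.mul_apply, h, ih, Equiv.Perm.mul_apply]
  cases k with
  | ofNat m => exact hn m x
  | negSucc m =>
    rw [zpow_negSucc, zpow_negSucc, Equiv.Perm.eq_inv_iff_eq, ← hn, ← Equiv.Perm.mul_apply,
      mul_inv_cancel, Equiv.Perm.one_apply]

namespace Triangulation

open Simplex

variable {n : ℕ} {T : Type*} (K : Triangulation n T)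

/-- A face of codimension two of a simplex `σ_t`, with an order of the two facets that contain it;
these are the facets opposite to the two given corners. -/
abbrev Flag (_K : Triangulation n T) : Type _ :=
  {x : T × Fin (n + 1) × Fin (n + 1) // x.2.1 ≠ x.2.2}

/-- The exchange of the two facets of a flag. -/
def flip (x : K.Flag) : K.Flag := ⟨(x.1.1, x.1.2.2, x.1.2.1), x.2.symm⟩

/-- The flag on the other side of the first facet of a flag. -/
def cross (x : K.Flag) : K.Flag :=
  ⟨((K.partner (x.1.1, x.1.2.1)).1, K.perspectivity (x.1.1, x.1.2.1) x.1.2.1,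
    K.perspectivity (x.1.1, x.1.2.1) x.1.2.2),
    fun h => x.2 ((K.perspectivity (x.1.1, x.1.2.1)).injective h)⟩

theorem flip_flip (x : K.Flag) : K.flip (K.flip x) = x := rfl

theorem cross_cross (x : K.Flag) : K.cross (K.cross x) = x := by
  obtain ⟨⟨t, i, j⟩, h⟩ := x
  have h1 : ((K.partner (t, i)).1, K.perspectivity (t, i) i) = K.partner (t, i) :=
    Prod.ext rfl (K.perspectivity_opposite (t, i))
  refine Subtype.ext ?_
  simp [cross, h1, K.partner_partner, K.perspectivity_partner]

theorem flip_ne (x : K.Flag) : K.flip x ≠ x := fun h =>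
  x.2 (congrArg (fun y : K.Flag => y.1.2.2) h)

theorem cross_ne (x : K.Flag) : K.cross x ≠ x := fun h =>
  K.partner_ne (x.1.1, x.1.2.1) (Prod.ext (congrArg (fun y : K.Flag => y.1.1) h)
    ((K.perspectivity_opposite (x.1.1, x.1.2.1)).symm.trans
      (congrArg (fun y : K.Flag => y.1.2.1) h)))

/-- The rotation of a flag around its face of codimension two. -/
def rot : Equiv.Perm K.Flag :=
  Function.Involutive.toPerm K.flip K.flip_flip * Function.Involutive.toPerm K.cross K.cross_cross

theorem rot_apply (x : K.Flag) : K.rot x = K.flip (K.cross x) := rfl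

theorem rot_zpow_ne_flip (k : ℤ) (x : K.Flag) : (K.rot ^ k) x ≠ K.flip x :=
  Equiv.Perm.zpow_mul_apply_ne_of_involutions (Equiv.ext K.flip_flip) (Equiv.ext K.cross_cross)
    K.flip_ne K.cross_ne k x

/-- The number of simplices around a face of codimension two. -/
noncomputable def period (x : K.Flag) : ℕ := Function.minimalPeriod (fun y => K.rot • y) x

theorem rot_zpow_eq_self_iff {k : ℤ} {x : K.Flag} :
    (K.rot ^ k) x = x ↔ (K.period x : ℤ) ∣ k :=
  MulAction.zpow_smul_eq_iff_minimalPeriod_dvd (a := K.rot) (b := x)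

/-- The point `a` of `σ_t` lies in the relative interior of the codimension two face of `x`. -/
def HasZeros (x : K.Flag) (t : T) (a : Simplex n) : Prop :=
  t = x.1.1 ∧ ∀ k, a.1 k = 0 ↔ k = x.1.2.1 ∨ k = x.1.2.2

variable {K}

theorem HasZeros.flip {x : K.Flag} {t : T} {a : Simplex n} (h : K.HasZeros x t a) :
    K.HasZeros (K.flip x) t a :=
  ⟨h.1, fun k => (h.2 k).trans or_comm⟩

theorem HasZeros.cross {x : K.Flag} {t : T} {a : Simplex n} (h : K.HasZeros x t a) :
    K.HasZeros (K.cross x) (K.partner (t, x.1.2.1)).1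
      (permute (K.perspectivity (t, x.1.2.1)) a) := by
  obtain ⟨rfl, h⟩ := h
  refine ⟨rfl, fun k => ?_⟩
  obtain ⟨k, rfl⟩ := (K.perspectivity (x.1.1, x.1.2.1)).surjective k
  rw [permute_apply_apply, h]
  simp [Triangulation.cross]

/-- A point in the relative interior of the face lies on just two facets: crossing the first is a
rotation step, crossing the second is its inverse. -/
theorem HasZeros.exists_rot {x : K.Flag} {t t' : T} {a a' : Simplex n} (h : K.HasZeros x t a)
    (he : K.proj ⟨t, a⟩ = K.proj ⟨t', a'⟩) : ∃ k : ℤ, K.HasZeros ((K.rot ^ k) x) t' a' := by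
  refine K.proj_eq_induction (x := ⟨t, a⟩) (y := ⟨t', a'⟩)
    (p := fun y => ∃ k : ℤ, K.HasZeros ((K.rot ^ k) x) y.1 y.2) ⟨0, h⟩ ?_ he
  rintro ⟨t', a'⟩ i ⟨k, hk⟩ hi
  rcases (hk.2 i).1 hi with rfl | rfl
  · refine ⟨1 + k, ?_⟩
    rw [zpow_add, zpow_one, Equiv.Perm.mul_apply, rot_apply]
    exact hk.cross.flip
  · refine ⟨-1 + k, ?_⟩
    have h1 : (K.rot ^ (-1 + k)) x = K.cross (K.flip ((K.rot ^ k) x)) := by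
      rw [zpow_add, zpow_neg, zpow_one, Equiv.Perm.mul_apply, Equiv.Perm.inv_eq_iff_eq, rot_apply,
        cross_cross, flip_flip]
    rw [h1]
    exact hk.flip.cross

theorem HasZeros.eq_or_eq_flip {x y : K.Flag} {t : T} {a : Simplex n} (h : K.HasZeros x t a)
    (h' : K.HasZeros y t a) : y = x ∨ y = K.flip x := by
  obtain ⟨⟨t₁, i, j⟩, hij⟩ := x
  obtain ⟨⟨t₂, i', j'⟩, hij'⟩ := y
  obtain ⟨rfl, h⟩ := h
  obtain ⟨rfl, h'⟩ := h'
  dsimp only at h h' hij hij'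
  have h1 := (h i').1 ((h' i').2 (Or.inl rfl))
  have h2 := (h j').1 ((h' j').2 (Or.inr rfl))
  rcases h1 with rfl | rfl <;> rcases h2 with rfl | rfl
  · exact absurd rfl hij'
  · exact Or.inl rfl
  · exact Or.inr rfl
  · exact absurd rfl hij'

variable (K)

/-- The barycentre of the codimension two face of the simplex opposite to two corners. -/
noncomputable def flagPoint (hn : 3 ≤ n) (i j : Fin (n + 1)) (hij : i ≠ j) : Simplex n :=
  ⟨fun k => if k = i ∨ k = j then 0 else 1 / ((n : ℝ) - 1), fun k => by
    have : (3 : ℝ) ≤ n := by exact_mod_cast hn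
    dsimp only
    split_ifs
    · exact le_rfl
    · exact div_nonneg zero_le_one (by linarith), by
    have h3 : (3 : ℝ) ≤ n := by exact_mod_cast hn
    have h1 : (Finset.univ.filter fun k => ¬ (k = i ∨ k = j)) = ({i, j} : Finset (Fin (n + 1)))ᶜ := by
      ext k
      simp
    rw [Finset.sum_ite, Finset.sum_const_zero, zero_add, h1, Finset.sum_const, Finset.card_compl,
      Finset.card_pair hij, Fintype.card_fin, nsmul_eq_mul, Nat.cast_sub (by omega)]
    push_cast
    have : (n : ℝ) - 1 ≠ 0 := by linarith
    field_simp
    ring⟩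

theorem flagPoint_apply (hn : 3 ≤ n) (i j : Fin (n + 1)) (hij : i ≠ j) (k : Fin (n + 1)) :
    (flagPoint hn i j hij).1 k = if k = i ∨ k = j then 0 else 1 / ((n : ℝ) - 1) := rfl

theorem flagPoint_mem (hn : 3 ≤ n) (i j : Fin (n + 1)) (hij : i ≠ j) :
    (flagPoint hn i j hij).1 ∈ puncturedSimplex n := by
  refine ⟨(flagPoint hn i j hij).2, fun k => ?_⟩
  have : (3 : ℝ) ≤ n := by exact_mod_cast hn
  rw [flagPoint_apply]
  split_ifs
  · exact one_pos
  · rw [div_lt_one (by linarith)]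
    linarith

theorem hasZeros_flagPoint (hn : 3 ≤ n) (x : K.Flag) :
    K.HasZeros x x.1.1 (flagPoint hn x.1.2.1 x.1.2.2 x.2) := by
  refine ⟨rfl, fun k => ?_⟩
  have : (3 : ℝ) ≤ n := by exact_mod_cast hn
  rw [flagPoint_apply, ite_eq_left_iff]
  refine ⟨fun h => ?_, fun h h' => absurd h h'⟩
  by_contra hk
  have := h hk
  rw [div_eq_zero_iff] at this
  rcases this with h | h <;> linarith

/-- The image of the barycentre of the codimension two face of a flag. -/
noncomputable def flagCenter (hn : 3 ≤ n) (x : K.Flag) : K.Space :=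
  K.proj ⟨x.1.1, flagPoint hn x.1.2.1 x.1.2.2 x.2⟩

theorem flagCenter_rot (hn : 3 ≤ n) (x : K.Flag) : K.flagCenter hn (K.rot x) = K.flagCenter hn x := by
  have h := K.proj_cross x.1.1 (flagPoint hn x.1.2.1 x.1.2.2 x.2) (i := x.1.2.1)
    (by simp [flagPoint_apply])
  refine Eq.trans ?_ h
  refine congrArg K.proj ?_
  rw [rot_apply]
  refine congrArg (Sigma.mk (K.partner (x.1.1, x.1.2.1)).1) (Subtype.ext (funext fun k => ?_))
  obtain ⟨k, rfl⟩ := (K.perspectivity (x.1.1, x.1.2.1)).surjective k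
  rw [permute_apply_apply, flagPoint_apply, flagPoint_apply]
  simp only [Triangulation.flip, Triangulation.cross, EmbeddingLike.apply_eq_iff_eq]
  simp only [or_comm]

theorem flagCenter_rot_zpow (hn : 3 ≤ n) (k : ℤ) (x : K.Flag) :
    K.flagCenter hn ((K.rot ^ k) x) = K.flagCenter hn x := by
  have := Equiv.Perm.apply_zpow_eq (g := K.rot) (g' := 1) (f := K.flagCenter hn)
    (K.flagCenter_rot hn) k x
  rwa [one_zpow] at this

/-- The image of the codimension two face of a flag. -/
def flagFace (x : K.Flag) : Set K.Space := K.proj '' K.face x.1.1 {x.1.2.1, x.1.2.2}ᶜ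

theorem mem_flagFace_iff {x : K.Flag} {z : K.Space} : z ∈ K.flagFace x ↔
    ∃ a : Simplex n, a.1 x.1.2.1 = 0 ∧ a.1 x.1.2.2 = 0 ∧ K.proj ⟨x.1.1, a⟩ = z := by
  constructor
  · rintro ⟨⟨t, a⟩, ⟨rfl, ha⟩, rfl⟩
    exact ⟨a, ha _ (by simp), ha _ (by simp), rfl⟩
  · rintro ⟨a, h1, h2, rfl⟩
    refine ⟨_, ⟨rfl, fun j hj => ?_⟩, rfl⟩
    simp only [Finset.mem_compl, Finset.mem_insert, Finset.mem_singleton, not_not] at hj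
    rcases hj with rfl | rfl
    exacts [h1, h2]

theorem flagFace_flip (x : K.Flag) : K.flagFace (K.flip x) = K.flagFace x := by
  ext z
  simp only [mem_flagFace_iff]
  exact exists_congr fun a => by tauto

theorem flagFace_subset_cross (x : K.Flag) : K.flagFace x ⊆ K.flagFace (K.cross x) := by
  intro z hz
  rw [mem_flagFace_iff] at hz ⊢
  obtain ⟨a, h1, h2, rfl⟩ := hz
  exact ⟨permute (K.perspectivity (x.1.1, x.1.2.1)) a, (permute_apply_apply _ _ _).trans h1,
    (permute_apply_apply _ _ _).trans h2, K.proj_cross x.1.1 a h1⟩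

theorem flagFace_rot (x : K.Flag) : K.flagFace (K.rot x) = K.flagFace x := by
  rw [rot_apply, flagFace_flip]
  refine (K.flagFace_subset_cross x).antisymm' ?_
  have := K.flagFace_subset_cross (K.cross x)
  rwa [cross_cross] at this

theorem flagFace_rot_zpow (k : ℤ) (x : K.Flag) : K.flagFace ((K.rot ^ k) x) = K.flagFace x := by
  have := Equiv.Perm.apply_zpow_eq (g := K.rot) (g' := 1) (f := K.flagFace) K.flagFace_rot k x
  rwa [one_zpow] at this

/-- The barycentre of the face of `x` is also the image of a point in the face of `y`. This point
has exactly two zero coordinates, so they determine the face. -/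
theorem exists_rot_of_flagFace_eq (hn : 3 ≤ n) {x y : K.Flag} (h : K.flagFace y = K.flagFace x) :
    ∃ k : ℤ, y = (K.rot ^ k) x ∨ y = K.flip ((K.rot ^ k) x) := by
  have h1 : K.flagCenter hn x ∈ K.flagFace y := by
    rw [h, mem_flagFace_iff]
    exact ⟨flagPoint hn x.1.2.1 x.1.2.2 x.2, ((K.hasZeros_flagPoint hn x).2 _).2 (Or.inl rfl),
      ((K.hasZeros_flagPoint hn x).2 _).2 (Or.inr rfl), rfl⟩
  obtain ⟨b, hb1, hb2, hb⟩ := K.mem_flagFace_iff.1 h1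
  obtain ⟨k, hk⟩ := (K.hasZeros_flagPoint hn x).exists_rot hb.symm
  refine ⟨k, hk.eq_or_eq_flip ⟨rfl, fun l => ?_⟩⟩
  rw [hk.2]
  have e1 := (hk.2 _).1 hb1
  have e2 := (hk.2 _).1 hb2
  have e3 := y.2
  have e4 := ((K.rot ^ k) x).2
  grind

/-- Forgetting the order of the two facets is injective on a rotation orbit, because the orbit
contains no flag together with its flip. -/
theorem degree_flagFace (hn : 3 ≤ n) (x : K.Flag) :
    K.degree (n - 2) (K.flagFace x) = K.period x := by
  have hcard : ∀ y : K.Flag, ({y.1.2.1, y.1.2.2}ᶜ : Finset (Fin (n + 1))).card = n - 2 + 1 := by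
    intro y
    rw [Finset.card_compl, Finset.card_pair y.2, Fintype.card_fin]
    omega
  -- Period zero means an infinite orbit, for which `Nat.card` is zero as well.
  rw [period, ← Nat.card_zmod (Function.minimalPeriod _ _),
    ← Nat.card_congr (MulAction.orbitZPowersEquiv K.rot x)]
  refine (Nat.card_congr (Equiv.ofBijective (fun y : MulAction.orbit (Subgroup.zpowers K.rot) x =>
    (⟨(y.1.1.1, {y.1.1.2.1, y.1.1.2.2}ᶜ), hcard y.1, ?_⟩ :
      {c : T × Finset (Fin (n + 1)) // c.2.card = n - 2 + 1 ∧
        K.proj '' K.face c.1 c.2 = K.flagFace x})) ⟨?_, ?_⟩)).symm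
  · obtain ⟨_, ⟨⟨_, k, rfl⟩, rfl⟩⟩ := y
    exact K.flagFace_rot_zpow k x
  · rintro ⟨_, ⟨⟨_, k, rfl⟩, rfl⟩⟩ ⟨_, ⟨⟨_, k', rfl⟩, rfl⟩⟩ he
    refine Subtype.ext ?_
    change (K.rot ^ k) x = (K.rot ^ k') x
    have he1 := congrArg (fun c => c.1.1) he
    have he2 := compl_injective (congrArg (fun c => c.1.2) he)
    change ((K.rot ^ k) x).1.1 = ((K.rot ^ k') x).1.1 at he1
    change ({((K.rot ^ k) x).1.2.1, ((K.rot ^ k) x).1.2.2} : Finset (Fin (n + 1))) =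
      {((K.rot ^ k') x).1.2.1, ((K.rot ^ k') x).1.2.2} at he2
    have hz := K.hasZeros_flagPoint hn ((K.rot ^ k) x)
    have hz' : K.HasZeros ((K.rot ^ k') x) ((K.rot ^ k) x).1.1
        (flagPoint hn ((K.rot ^ k) x).1.2.1 ((K.rot ^ k) x).1.2.2 ((K.rot ^ k) x).2) := by
      refine ⟨he1, fun l => ?_⟩
      have := Finset.ext_iff.1 he2 l
      simp only [Finset.mem_insert, Finset.mem_singleton] at this
      rw [hz.2, this]
    rcases hz'.eq_or_eq_flip hz with h | h
    · exact h
    · have h2 := K.rot_zpow_ne_flip (k - k') ((K.rot ^ k') x)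
      rw [← Equiv.Perm.mul_apply, ← zpow_add, sub_add_cancel] at h2
      exact absurd h h2
  · rintro ⟨⟨t, F⟩, hF, hS⟩
    dsimp only at hF hS
    have hF' : Fᶜ.card = 2 := by
      rw [Finset.card_compl, hF, Fintype.card_fin]
      omega
    obtain ⟨i, j, hij, he⟩ := Finset.card_eq_two.1 hF'
    have hFe : F = {i, j}ᶜ := by rw [← he, compl_compl]
    subst hFe
    obtain ⟨k, hk | hk⟩ := K.exists_rot_of_flagFace_eq hn (x := x) (y := ⟨(t, i, j), hij⟩) hS
    · refine ⟨⟨(K.rot ^ k) x, ⟨⟨_, k, rfl⟩, rfl⟩⟩, Subtype.ext ?_⟩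
      dsimp only
      rw [← hk]
    · refine ⟨⟨(K.rot ^ k) x, ⟨⟨_, k, rfl⟩, rfl⟩⟩, Subtype.ext ?_⟩
      have hk' : (K.rot ^ k) x = ⟨(t, j, i), hij.symm⟩ := by
        rw [← K.flip_flip ((K.rot ^ k) x), ← hk]
        rfl
      dsimp only
      rw [hk', Finset.pair_comm]

theorem isEven_iff_even_period (hn : 3 ≤ n) : K.IsEven ↔ ∀ x : K.Flag, Even (K.period x) := by
  constructor
  · intro h x
    rw [← K.degree_flagFace hn]
    refine h _ ⟨x.1.1, _, ?_, rfl⟩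
    rw [Finset.card_compl, Finset.card_pair x.2, Fintype.card_fin]
    omega
  · rintro h S ⟨t, F, hF, rfl⟩
    have hF' : Fᶜ.card = 2 := by
      rw [Finset.card_compl, hF, Fintype.card_fin]
      omega
    obtain ⟨i, j, hij, he⟩ := Finset.card_eq_two.1 hF'
    have hFe : F = {i, j}ᶜ := by rw [← he, compl_compl]
    subst hFe
    have := h ⟨(t, i, j), hij⟩
    rwa [← K.degree_flagFace hn] at this

end Triangulation

/-! ### Labels around codimension two faces: even degrees and good points. -/

namespace Triangulation

open Simplex

variable {n : ℕ} {T : Type*} (K : Triangulation n T)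

/-- The flag without the label of its simplex. -/
def forgetFlag (x : K.cover.Flag) : K.Flag := ⟨(x.1.1.1, x.1.2.1, x.1.2.2), x.2⟩

/-- The flag with a label of its simplex. -/
def labelFlag (s : Equiv.Perm (Fin (n + 1))) (x : K.Flag) : K.cover.Flag :=
  ⟨((x.1.1, s), x.1.2.1, x.1.2.2), x.2⟩

theorem forgetFlag_rot (x : K.cover.Flag) : K.forgetFlag (K.cover.rot x) = K.rot (K.forgetFlag x) := by
  rw [rot_apply, rot_apply]
  refine Subtype.ext ?_
  simp only [forgetFlag, flip, cross, cover_perspectivity]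
  rfl

theorem forgetFlag_rot_zpow (k : ℤ) (x : K.cover.Flag) :
    K.forgetFlag ((K.cover.rot ^ k) x) = (K.rot ^ k) (K.forgetFlag x) :=
  Equiv.Perm.apply_zpow_eq K.forgetFlag_rot k x

/-- The corners of a labelled flag, transported back by the label. -/
def flagLabel (x : K.cover.Flag) : Fin (n + 1) × Fin (n + 1) :=
  (x.1.1.2⁻¹ x.1.2.1, x.1.1.2⁻¹ x.1.2.2)

/-- The perspectivity acts on corners and on the label alike and cancels; only the exchange of the
two facets remains. -/
theorem flagLabel_rot (x : K.cover.Flag) :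
    K.flagLabel (K.cover.rot x) = (K.flagLabel x).swap := by
  rw [rot_apply]
  have h : ∀ (p s : Equiv.Perm (Fin (n + 1))) k, (p * s)⁻¹ (p k) = s⁻¹ k := fun p s k => by
    rw [mul_inv_rev, Equiv.Perm.mul_apply, ← Equiv.Perm.mul_apply p⁻¹, inv_mul_cancel,
      Equiv.Perm.one_apply]
  exact Prod.ext (h (K.perspectivity (x.1.1.1, x.1.2.1)) _ _)
    (h (K.perspectivity (x.1.1.1, x.1.2.1)) _ _)

/-- The orientation of a labelled simplex, compared with the one given by its label. -/
def flagSign (x : K.cover.Flag) : ℤˣ := Equiv.Perm.sign x.1.1.2 * K.orientation x.1.1.1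

theorem flagSign_rot (x : K.cover.Flag) : K.flagSign (K.cover.rot x) = -K.flagSign x := by
  have h := K.orientation_reversing (x.1.1.1, x.1.2.1)
  change Equiv.Perm.sign (K.perspectivity (x.1.1.1, x.1.2.1) * x.1.1.2) *
    K.orientation (K.partner (x.1.1.1, x.1.2.1)).1 = -(_ * K.orientation x.1.1.1)
  rw [Equiv.Perm.sign_mul]
  dsimp only at h
  have h2 : K.orientation x.1.1.1 * K.orientation x.1.1.1 = 1 := Int.units_mul_self _
  calc _ = Equiv.Perm.sign x.1.1.2 * (K.orientation x.1.1.1 * K.orientation x.1.1.1) *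
        (Equiv.Perm.sign (K.perspectivity (x.1.1.1, x.1.2.1)) *
          K.orientation (K.partner (x.1.1.1, x.1.2.1)).1) := by
        rw [h2, mul_one]; ac_rfl
    _ = Equiv.Perm.sign x.1.1.2 * K.orientation x.1.1.1 *
        (Equiv.Perm.sign (K.perspectivity (x.1.1.1, x.1.2.1)) * K.orientation x.1.1.1 *
          K.orientation (K.partner (x.1.1.1, x.1.2.1)).1) := by ac_rfl
    _ = _ := by rw [h, mul_neg_one]

theorem flagLabel_rot_zpow_of_even {k : ℤ} (hk : Even k) (x : K.cover.Flag) :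
    K.flagLabel ((K.cover.rot ^ k) x) = K.flagLabel x ∧
      K.flagSign ((K.cover.rot ^ k) x) = K.flagSign x := by
  obtain ⟨m, rfl⟩ := hk
  have h := Equiv.Perm.apply_zpow_eq (g := K.cover.rot * K.cover.rot) (g' := 1)
    (f := fun x => (K.flagLabel x, K.flagSign x)) (fun x => by
      rw [Equiv.Perm.mul_apply, flagLabel_rot, flagLabel_rot, flagSign_rot, flagSign_rot,
        Prod.swap_swap, neg_neg, Equiv.Perm.one_apply]) m x
  rw [one_zpow, ← pow_two, ← zpow_natCast, ← zpow_mul, Nat.cast_ofNat, two_mul] at h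
  exact ⟨congrArg Prod.fst h, congrArg Prod.snd h⟩

theorem labelFlag_surjective (y : K.cover.Flag) : ∃ s, K.labelFlag s (K.forgetFlag y) = y :=
  ⟨y.1.1.2, rfl⟩

/-- Such a point lies on at most one facet, so the only possible moves are one crossing and its
reversal. A single crossing cannot return to the same position, as no facet is its own partner. -/
theorem isGood_of_le_one_zero {t : T} {a : Simplex n}
    (ha : ∀ i j, a.1 i = 0 → a.1 j = 0 → i = j) : K.IsGood (K.proj ⟨t, a⟩) := by
  refine K.isGood_of_forall fun s s' h => ?_
  have h' : (t = t ∧ s' = s ∧ a = a) ∨ ∃ i, a.1 i = 0 ∧ t = (K.partner (t, i)).1 ∧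
      s' = K.perspectivity (t, i) * s ∧ a = permute (K.perspectivity (t, i)) a := by
    refine K.lift_eq_induction (p := fun t' s' a' => (t' = t ∧ s' = s ∧ a' = a) ∨
      ∃ i, a.1 i = 0 ∧ t' = (K.partner (t, i)).1 ∧ s' = K.perspectivity (t, i) * s ∧
        a' = permute (K.perspectivity (t, i)) a) (Or.inl ⟨rfl, rfl, rfl⟩) ?_ h
    rintro t' s' a' i (⟨rfl, rfl, rfl⟩ | ⟨j, hj, rfl, rfl, rfl⟩) hi
    · exact Or.inr ⟨i, hi, rfl, rfl, rfl⟩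
    · left
      have hij : i = (K.partner (t, j)).2 := by
        obtain ⟨l, rfl⟩ := (K.perspectivity (t, j)).surjective i
        rw [permute_apply_apply] at hi
        rw [ha l j hi hj]
        exact K.perspectivity_opposite (t, j)
      have hp : ((K.partner (t, j)).1, i) = K.partner (t, j) := Prod.ext rfl hij
      rw [hp, K.partner_partner, K.perspectivity_partner, inv_mul_cancel_left, ← permute_mul,
        inv_mul_cancel, permute_one]
      exact ⟨rfl, rfl, rfl⟩
  rcases h' with ⟨-, h, -⟩ | ⟨i, hi, ht, -, hp⟩
  · exact h.symm
  · exfalso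
    have h1 : a.1 (K.perspectivity (t, i) i) = 0 := by
      rw [hp, permute_apply_apply, hi]
    have h2 := ha _ _ h1 hi
    exact K.partner_ne (t, i) (Prod.ext ht.symm ((K.perspectivity_opposite (t, i)).symm.trans h2))

/-- A coincidence of labels comes from a full number of turns, hence from an even number of
crossings. The quotient `σ` of the labels then fixes both outer corners, is even, and preserves the
coordinates of `a`. -/
theorem isGood_of_hasZeros {x : K.Flag} (hx : Even (K.period x)) {t : T} {a : Simplex n}
    (ha : K.HasZeros x t a) (h : n = 3 ∨ ∀ k l, a.1 k ≠ 0 → a.1 k = a.1 l → k = l) :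
    K.IsGood (K.proj ⟨t, a⟩) := by
  refine K.isGood_of_forall fun s s' he => ?_
  have hz : ∀ r, K.cover.HasZeros (K.labelFlag r x) (t, r) a := fun r =>
    ⟨Prod.ext ha.1 rfl, ha.2⟩
  obtain ⟨k, hk⟩ := (hz s).exists_rot he
  have hrot : (K.rot ^ k) x = K.forgetFlag ((K.cover.rot ^ k) (K.labelFlag s x)) :=
    (K.forgetFlag_rot_zpow k (K.labelFlag s x)).symm
  have hcase : (K.cover.rot ^ k) (K.labelFlag s x) = K.labelFlag s' x := by
    -- Rotations cannot exchange the two facets, so the flag returns in its original order.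
    refine ((hz s').eq_or_eq_flip hk).resolve_right fun h => ?_
    rw [h] at hrot
    exact K.rot_zpow_ne_flip k x hrot
  rw [hcase] at hrot
  have hk2 : Even k :=
    ((Int.even_coe_nat _).2 hx).trans_dvd (K.rot_zpow_eq_self_iff.1 hrot)
  obtain ⟨hl, hs⟩ := K.flagLabel_rot_zpow_of_even hk2 (K.labelFlag s x)
  rw [hcase] at hl hs
  have hi : s'⁻¹ x.1.2.1 = s⁻¹ x.1.2.1 := congrArg Prod.fst hl
  have hj : s'⁻¹ x.1.2.2 = s⁻¹ x.1.2.2 := congrArg Prod.snd hl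
  have hsign : Equiv.Perm.sign s' = Equiv.Perm.sign s := mul_right_cancel hs
  have hperm := K.lift_eq_permute he
  set σ := s' * s⁻¹ with hσ
  have hfix : ∀ {k}, s'⁻¹ k = s⁻¹ k → σ k = k := by
    intro k hk
    rw [hσ, Equiv.Perm.mul_apply, ← hk, ← Equiv.Perm.mul_apply, mul_inv_cancel,
      Equiv.Perm.one_apply]
  suffices σ = 1 by
    rw [hσ, mul_inv_eq_one] at this
    exact this.symm
  rcases h with rfl | h
  · have hσ1 : Equiv.Perm.sign σ = 1 := by
      rw [hσ, Equiv.Perm.sign_mul, Equiv.Perm.sign_inv, hsign, Int.units_mul_self]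
    by_contra hne
    have h1 := Equiv.Perm.one_lt_card_support_of_ne_one hne
    -- For n = 3 only two corners can move, so `σ ≠ 1` would be a transposition, which is odd.
    have h2 : σ.support ⊆ {x.1.2.1, x.1.2.2}ᶜ := by
      intro k hk
      rw [Equiv.Perm.mem_support] at hk
      simp only [Finset.mem_compl, Finset.mem_insert, Finset.mem_singleton, not_or]
      exact ⟨fun h => hk (by rw [h, hfix hi]), fun h => hk (by rw [h, hfix hj])⟩
    have h3 := Finset.card_le_card h2
    rw [Finset.card_compl, Finset.card_pair x.2, Fintype.card_fin] at h3
    have h4 := Equiv.Perm.card_support_eq_two.1 (by omega : σ.support.card = 2)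
    rw [h4.sign_eq] at hσ1
    exact absurd hσ1 (by decide)
  · ext k
    rw [Equiv.Perm.one_apply]
    congr 1
    by_cases hk : a.1 k = 0
    · rcases (ha.2 k).1 hk with rfl | rfl
      exacts [hfix hi, hfix hj]
    · have h1 : a.1 (σ k) = a.1 k := by
        conv_lhs => rw [hperm]
        rw [permute_apply_apply]
      exact (h k _ hk h1.symm).symm

/-- The simplices reachable from `σ_{t₀}` have a clopen image. -/
theorem exists_dualPath [ConnectedSpace K.Space] (t₀ t : T) : Nonempty (K.DualPath t₀ t) := by
  let R : Set K.Points := {x | Nonempty (K.DualPath t₀ x.1)}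
  have hR : ∀ {x y : K.Points}, K.proj x = K.proj y → x ∈ R → y ∈ R := by
    intro x y h hx
    refine K.proj_eq_induction (p := fun y => y ∈ R) hx ?_ h
    rintro y i ⟨δ⟩ -
    exact ⟨δ.append (.single (y.1, i))⟩
  have hpre : K.proj ⁻¹' (K.proj '' R) = R :=
    Set.Subset.antisymm (fun y ⟨x, hx, h⟩ => hR h hx) (Set.subset_preimage_image _ _)
  have hclopen : ∀ A : Set T, IsClopen (Sigma.fst ⁻¹' A : Set K.Points) := by
    have hopen : ∀ A : Set T, IsOpen (Sigma.fst ⁻¹' A : Set K.Points) := fun A =>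
      isOpen_sigma_iff.2 fun t => isOpen_const (p := t ∈ A)
    exact fun A => ⟨⟨hopen Aᶜ⟩, hopen A⟩
  have hq : IsQuotientMap K.proj := isQuotientMap_quot_mk
  have hc : IsClopen (K.proj '' R) := by
    rw [← hq.isClopen_preimage, hpre]
    exact hclopen {t | Nonempty (K.DualPath t₀ t)}
  rcases isClopen_iff.1 hc with h | h
  · rw [Set.image_eq_empty] at h
    exact absurd (show (⟨t₀, barycentre n⟩ : K.Points) ∈ R from ⟨.nil t₀⟩) (by rw [h]; simp)
  · have h1 : (⟨t, barycentre n⟩ : K.Points) ∈ R := by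
      rw [← hpre, h]
      trivial
    exact h1

/-- Inserting `γ` in a loop at the base point changes neither the homotopy class nor, therefore, the
projectivity. -/
theorem IsCanonicalRep.eq_one_of_homotopic_refl [ConnectedSpace K.Space] {hn : 3 ≤ n} {t₀ : T}
    {ρ : FundamentalGroup K.M (K.dualVertex hn t₀) →* Equiv.Perm (Fin (n + 1))}
    (hρ : K.IsCanonicalRep hn t₀ ρ) {t : T} (γ : K.DualPath t t)
    (h : Path.Homotopic.Quotient.mk (γ.toPath hn) = .refl _) : γ.projectivity = 1 := by
  obtain ⟨α⟩ := K.exists_dualPath t₀ t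
  obtain ⟨β⟩ := K.exists_dualPath t t₀
  have h1 := (hρ _ _).2 ⟨α.append (γ.append β), rfl, rfl⟩
  have h2 := (hρ _ _).2 ⟨α.append β, rfl, rfl⟩
  rw [DualPath.mk_toPath_append, DualPath.mk_toPath_append, h, Path.Homotopic.Quotient.refl_trans,
    ← DualPath.mk_toPath_append, h2] at h1
  simp only [DualPath.projectivity_append, mul_assoc] at h1
  have h3 := mul_left_cancel h1
  exact (right_eq_mul.1 h3)

theorem IsCanonicalRep.isEven [ConnectedSpace K.Space] {hn : 3 ≤ n} {t₀ : T}
    {ρ : FundamentalGroup K.M (K.dualVertex hn t₀) →* Equiv.Perm (Fin (n + 1))}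
    (hρ : K.IsCanonicalRep hn t₀ ρ) : K.IsEven := by
  rw [K.isEven_iff_even_period hn]
  intro x
  by_contra hodd
  rw [Nat.not_even_iff_odd] at hodd
  set y := (K.cover.rot ^ (K.period x : ℤ)) (K.labelFlag 1 x) with hy
  have hyx : K.forgetFlag y = x :=
    (K.forgetFlag_rot_zpow _ (K.labelFlag 1 x)).trans (K.rot_zpow_eq_self_iff.2 dvd_rfl)
  obtain ⟨s, hs⟩ := K.labelFlag_surjective y
  rw [hyx] at hs
  have hlift : K.lift x.1.1 1 (flagPoint hn x.1.2.1 x.1.2.2 x.2) =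
      K.lift x.1.1 s (flagPoint hn x.1.2.1 x.1.2.2 x.2) := by
    have := K.cover.flagCenter_rot_zpow hn (K.period x) (K.labelFlag 1 x)
    rw [← hy, ← hs] at this
    exact this.symm
  obtain ⟨hm, δ, hδ, hspoke⟩ := K.exists_dualPath_of_lift_eq hn
    (flagPoint_mem hn x.1.2.1 x.1.2.2 x.2) hlift
  have hnull : Path.Homotopic.Quotient.mk (δ.toPath hn) = .refl _ := by
    have h := congrArg (fun q => q.trans (K.spoke hn x.1.1
      ⟨(flagPoint hn x.1.2.1 x.1.2.2 x.2).1, hm⟩ _ rfl).symm) (hspoke _ rfl rfl)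
    simpa only [Path.Homotopic.Quotient.trans_assoc, Path.Homotopic.Quotient.trans_symm,
      Path.Homotopic.Quotient.trans_refl] using h.symm
  have hs1 : s = 1 := by
    rw [← hδ, mul_one]
    exact hρ.eq_one_of_homotopic_refl K δ hnull
  obtain ⟨m, hm⟩ := hodd
  -- An odd number of exchanges is one exchange; with trivial label `s` the two distinct corners of
  -- `x` would coincide.
  have hlabel : K.flagLabel y = (K.flagLabel (K.labelFlag 1 x)).swap := by
    have hmz : (K.period x : ℤ) = 1 + 2 * (m : ℤ) := by
      rw [hm]; push_cast; ring
    rw [hy, hmz, zpow_add, zpow_one, Equiv.Perm.mul_apply, flagLabel_rot,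
      (K.flagLabel_rot_zpow_of_even (even_two_mul _) _).1]
  rw [← hs, hs1] at hlabel
  exact x.2 (congrArg Prod.fst hlabel)

end Triangulation

/-! ### General position in piecewise affine charts. -/

open MeasureTheory in
/-- The apexes of the cones over a line `L' (w₀ w₁)` which meet the image under `L` of an affine
subspace of codimension three of the hyperplane of barycentric coordinates form a null set. -/
theorem volume_apexes_eq_zero {n : ℕ} (hn : 3 ≤ n)
    (L L' : (Fin (n + 1) → ℝ) →ᵃ[ℝ] EuclideanSpace ℝ (Fin n)) (p w₀ w₁ : Fin (n + 1) → ℝ)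
    {Q : Finset (Fin (n + 1))} (hQ : Q.card = 4) :
    volume {c : EuclideanSpace ℝ (Fin n) | ∃ a : Fin (n + 1) → ℝ, ∃ μ : ℝ,
      a - p ∈ Submodule.span ℝ ((fun m => Pi.single m 1 - p) '' (Qᶜ : Finset (Fin (n + 1)))) ∧
      L a ∈ segment ℝ c (L' (w₀ + μ • (w₁ - w₀))) ∧ L a ≠ L' (w₀ + μ • (w₁ - w₀))} = 0 := by
  classical
  -- There are at most 1 + 1 + (n - 3) generators: the direction of the line, a vector between the
  -- two affine images, and one for each corner outside `Q`.
  let F : Finset (EuclideanSpace ℝ (Fin n)) := insert (L'.linear (w₁ - w₀))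
    (insert (L p - L' w₀) (Qᶜ.image fun m => L.linear (Pi.single m 1 - p)))
  let W := Submodule.span ℝ (F : Set (EuclideanSpace ℝ (Fin n)))
  have hW : W ≠ ⊤ := by
    intro h
    have h1 : Module.finrank ℝ W ≤ F.card := finrank_span_finset_le_card F
    rw [h, finrank_top, finrank_euclideanSpace_fin] at h1
    have h2 : F.card ≤ (n - 3) + 1 + 1 := by
      refine (Finset.card_insert_le _ _).trans (Nat.succ_le_succ ?_)
      refine (Finset.card_insert_le _ _).trans (Nat.succ_le_succ ?_)
      refine Finset.card_image_le.trans ?_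
      rw [Finset.card_compl, hQ, Fintype.card_fin]
      omega
    omega
  have hnull : volume ((fun c => c + -L' w₀) ⁻¹' (W : Set (EuclideanSpace ℝ (Fin n)))) = 0 := by
    rw [measure_preimage_add_right]
    exact Measure.addHaar_submodule volume W hW
  refine measure_mono_null ?_ hnull
  rintro c ⟨a, μ, ha, ⟨α, β, hα, hβ, hαβ, he⟩, hne⟩
  have hα0 : α ≠ 0 := by
    rintro rfl
    rw [zero_add] at hαβ
    rw [hαβ, zero_smul, one_smul, zero_add] at he
    exact hne he.symm
  have hy : L' (w₀ + μ • (w₁ - w₀)) - L' w₀ = μ • L'.linear (w₁ - w₀) := by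
    rw [← map_smul, ← vsub_eq_sub (L' _), ← AffineMap.linearMap_vsub]
    simp
  have hz : L a - L p = L.linear (a - p) := by
    rw [← vsub_eq_sub (L _), ← AffineMap.linearMap_vsub]
    rfl
  have hmem : L.linear (a - p) ∈ W := by
    have h1 := Submodule.mem_map_of_mem (f := L.linear) ha
    rw [Submodule.map_span] at h1
    refine Submodule.span_mono ?_ h1
    rintro _ ⟨_, ⟨m, hm, rfl⟩, rfl⟩
    exact Finset.mem_coe.2 (Finset.mem_insert_of_mem (Finset.mem_insert_of_mem
      (Finset.mem_image_of_mem _ hm)))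
  have hr : L p - L' w₀ ∈ W := Submodule.subset_span (by simp [F])
  have hd : L'.linear (w₁ - w₀) ∈ W := Submodule.subset_span (by simp [F])
  change c + -L' w₀ ∈ W
  -- Solve `L a = α c + β y` for the apex, where `y` is the point of the line; `α ≠ 0` because `L a
  -- ≠ y`.
  have hc : α • (c + -L' w₀) = (L p - L' w₀) + L.linear (a - p) -
      β • (μ • L'.linear (w₁ - w₀)) := by
    rw [← hy, ← hz, ← he]
    generalize L' (w₀ + μ • (w₁ - w₀)) = y
    rw [smul_sub, smul_add, smul_neg]
    have : β • L' w₀ = L' w₀ - α • L' w₀ := by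
      rw [eq_sub_iff_add_eq', ← add_smul, hαβ, one_smul]
    rw [this]
    abel
  rw [← inv_smul_smul₀ hα0 (c + -L' w₀), hc]
  exact W.smul_mem _ (W.sub_mem (W.add_mem hr hmem) (W.smul_mem _ (W.smul_mem _ hd)))

/-- The coordinates in `Q` contribute `r • p`. As the total weight is 1, `a` is an affine
combination of `p` and the corners outside `Q`. -/
theorem Simplex.eq_smul_add_sum {n : ℕ} (a : Simplex n) {p : Fin (n + 1) → ℝ}
    (Q : Finset (Fin (n + 1))) {r : ℝ} (hr : ∑ m ∈ Q, a.1 m = r)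
    (hp : ∑ m ∈ Q, a.1 m • (Pi.single m 1 : Fin (n + 1) → ℝ) = r • p) :
    a.1 - p ∈ Submodule.span ℝ
      ((fun m => (Pi.single m 1 - p : Fin (n + 1) → ℝ)) '' (Qᶜ : Finset (Fin (n + 1)))) := by
  have h1 : a.1 = ∑ m ∈ Q, a.1 m • (Pi.single m 1 : Fin (n + 1) → ℝ) +
      ∑ m ∈ Qᶜ, a.1 m • (Pi.single m 1 : Fin (n + 1) → ℝ) := by
    rw [Finset.sum_add_sum_compl]
    exact pi_eq_sum_univ' a.1
  have h2 : r + ∑ m ∈ Qᶜ, a.1 m = 1 := by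
    rw [← hr, Finset.sum_add_sum_compl]
    exact a.2.2
  have h3 : a.1 - p = ∑ m ∈ Qᶜ, a.1 m • (Pi.single m 1 - p : Fin (n + 1) → ℝ) := by
    simp only [smul_sub, Finset.sum_sub_distrib, ← Finset.sum_smul]
    conv_lhs => rw [h1, hp]
    rw [← eq_sub_iff_add_eq] at h2
    rw [h2, sub_smul, one_smul]
    abel
  rw [h3]
  exact Submodule.sum_mem _ fun m hm => Submodule.smul_mem _ _ (Submodule.subset_span ⟨m, hm, rfl⟩)

namespace Triangulation

open Simplex

variable {n : ℕ} {T : Type*} (K : Triangulation n T)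

/-- The points of the simplices which are not good lie in finitely many affine subspaces of
codimension three. -/
theorem exists_subspace_of_not_isGood (hn : 3 ≤ n) (hK : K.IsEven) {t : T} {a : Simplex n}
    (h : ¬ K.IsGood (K.proj ⟨t, a⟩)) : ∃ (b : Bool) (k l : Fin (n + 1)) (Q : Finset (Fin (n + 1))),
    Q.card = 4 ∧ a.1 - (bif b then Pi.single l 1 else
        (1 / 2 : ℝ) • (Pi.single k 1 + Pi.single l 1) : Fin (n + 1) → ℝ) ∈
      Submodule.span ℝ ((fun m => (Pi.single m 1 - (bif b then Pi.single l 1 else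
        (1 / 2 : ℝ) • (Pi.single k 1 + Pi.single l 1)) : Fin (n + 1) → ℝ)) ''
          (Qᶜ : Finset (Fin (n + 1)))) := by
  obtain ⟨i, j, hi, hj, hij⟩ : ∃ i j, a.1 i = 0 ∧ a.1 j = 0 ∧ i ≠ j := by
    by_contra! hall
    exact h (K.isGood_of_le_one_zero hall)
  by_cases hk : ∃ k, k ≠ i ∧ k ≠ j ∧ a.1 k = 0
  · obtain ⟨k, hki, hkj, hk⟩ := hk
    obtain ⟨l, hl⟩ : ∃ l, l ∉ ({i, j, k} : Finset (Fin (n + 1))) := by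
      by_contra! hall
      have h1 := Finset.card_le_card (fun x _ => hall x : Finset.univ ⊆ _)
      have h2 := Finset.card_le_three (a := i) (b := j) (c := k)
      rw [Finset.card_univ, Fintype.card_fin] at h1
      omega
    simp only [Finset.mem_insert, Finset.mem_singleton, not_or] at hl
    obtain ⟨hli, hlj, hlk⟩ := hl
    have e1 : i ∉ ({j, k, l} : Finset (Fin (n + 1))) := by
      simp [hij, hki.symm, Ne.symm hli]
    have e2 : j ∉ ({k, l} : Finset (Fin (n + 1))) := by
      simp [hkj.symm, Ne.symm hlj]
    have e3 : k ∉ ({l} : Finset (Fin (n + 1))) := by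
      simp [Ne.symm hlk]
    -- With three zero coordinates, any fourth corner serves as base point.
    refine ⟨true, k, l, {i, j, k, l}, ?_, a.eq_smul_add_sum _ (r := a.1 l) ?_ ?_⟩
    · rw [Finset.card_insert_of_notMem e1, Finset.card_insert_of_notMem e2,
        Finset.card_insert_of_notMem e3, Finset.card_singleton]
    · rw [Finset.sum_insert e1, Finset.sum_insert e2, Finset.sum_insert e3, Finset.sum_singleton,
        hi, hj, hk, zero_add, zero_add, zero_add]
    · rw [Finset.sum_insert e1, Finset.sum_insert e2, Finset.sum_insert e3, Finset.sum_singleton,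
        hi, hj, hk, zero_smul, zero_smul, zero_smul, zero_add, zero_add, zero_add, cond_true]
  · have hz : K.HasZeros ⟨(t, i, j), hij⟩ t a := by
      refine ⟨rfl, fun k => ⟨fun h0 => ?_, ?_⟩⟩
      · by_contra hne
        exact hk ⟨k, fun h => hne (Or.inl h), fun h => hne (Or.inr h), h0⟩
      · rintro (rfl | rfl)
        exacts [hi, hj]
    have hgen : ¬ ∀ k l, a.1 k ≠ 0 → a.1 k = a.1 l → k = l := fun hg =>
      h (K.isGood_of_hasZeros ((K.isEven_iff_even_period hn).1 hK _) hz (Or.inr hg))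
    push Not at hgen
    obtain ⟨k, l, hk0, hkl, hne⟩ := hgen
    have hl0 : a.1 l ≠ 0 := hkl ▸ hk0
    have ne_of : ∀ {u v : Fin (n + 1)}, a.1 u = 0 → a.1 v ≠ 0 → u ≠ v := fun hu hv h => hv (h ▸ hu)
    have e1 : i ∉ ({j, k, l} : Finset (Fin (n + 1))) := by
      simp [hij, ne_of hi hk0, ne_of hi hl0]
    have e2 : j ∉ ({k, l} : Finset (Fin (n + 1))) := by
      simp [ne_of hj hk0, ne_of hj hl0]
    have e3 : k ∉ ({l} : Finset (Fin (n + 1))) := by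
      simp [hne]
    -- With two zeros and two equal coordinates, the base point is the midpoint of the two corners
    -- `k` and `l`.
    refine ⟨false, k, l, {i, j, k, l}, ?_, a.eq_smul_add_sum _ (r := 2 * a.1 l) ?_ ?_⟩
    · rw [Finset.card_insert_of_notMem e1, Finset.card_insert_of_notMem e2,
        Finset.card_insert_of_notMem e3, Finset.card_singleton]
    · rw [Finset.sum_insert e1, Finset.sum_insert e2, Finset.sum_insert e3, Finset.sum_singleton,
        hi, hj, hkl, zero_add, zero_add, two_mul]
    · rw [Finset.sum_insert e1, Finset.sum_insert e2, Finset.sum_insert e3, Finset.sum_singleton,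
        hi, hj, hkl, zero_smul, zero_smul, zero_add, zero_add, cond_false, smul_smul]
      rw [mul_one_div, mul_div_cancel_left₀ _ two_ne_zero, smul_add]

/-- The points close to the points over `x` on the dual graph that is contracted to `x`. -/
def contractedGraph (hn : 3 ≤ n) (x : K.Space) (η : unitInterval) : Set K.Space :=
  {z | ∃ t a i τ, K.proj ⟨t, a⟩ = x ∧ z = K.proj ⟨t, Simplex.segment a (segmentPoint hn i τ) η⟩}

/-- Each gluing of points over `x` across a facet is followed by a contracted dual edge, since the
point and the facet barycentre lie on this facet together. -/
theorem joinedIn_contractedGraph (hn : 3 ≤ n) {x : K.Space} (η : unitInterval) {t t' : T}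
    {s s' : Equiv.Perm (Fin (n + 1))} {a a' : Simplex n} (hx : K.proj ⟨t, a⟩ = x)
    (h : K.lift t s a = K.lift t' s' a') : JoinedIn (K.forget ⁻¹' K.contractedGraph hn x η)
      (K.lift t s (Simplex.segment a (barycentre n) η))
      (K.lift t' s' (Simplex.segment a' (barycentre n) η)) := by
  have half : ∀ t s a i, K.proj ⟨t, a⟩ = x → JoinedIn (K.forget ⁻¹' K.contractedGraph hn x η)
      (K.lift t s (Simplex.segment a (barycentre n) η))
      (K.lift t s (Simplex.segment a (facetBarycentre hn i) η)) := by
    intro t s a i hx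
    refine ⟨⟨⟨fun τ => K.lift t s (Simplex.segment a (segmentPoint hn i τ) η), ?_⟩, ?_, ?_⟩,
      fun τ => ⟨t, a, i, τ, hx, rfl⟩⟩
    · refine K.cover.continuous_proj.comp (continuous_sigmaMk.comp ?_)
      refine Continuous.subtype_mk ?_ _
      have := continuous_subtype_val.comp (continuous_segmentPoint hn i)
      exact continuous_const.add (this.const_smul η.1)
    · exact congrArg (fun w => K.lift t s (Simplex.segment a w η)) (segmentPoint_zero hn i)
    · exact congrArg (fun w => K.lift t s (Simplex.segment a w η)) (segmentPoint_one hn i)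
  refine (K.lift_eq_induction (p := fun t' s' a' => K.proj ⟨t', a'⟩ = x ∧
    JoinedIn (K.forget ⁻¹' K.contractedGraph hn x η)
      (K.lift t s (Simplex.segment a (barycentre n) η))
      (K.lift t' s' (Simplex.segment a' (barycentre n) η))) ⟨hx, ?_⟩ ?_ h).2
  · exact JoinedIn.refl ⟨t, a, 0, 0, hx, by rw [segmentPoint_zero]; rfl⟩
  · rintro t' s' a' i ⟨hx', hj⟩ hi
    have hx'' := (K.proj_cross t' a' hi).trans hx'
    refine ⟨hx'', (hj.trans (half t' s' a' i hx')).trans ?_⟩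
    have h1 := (half _ (K.perspectivity (t', i) * s') _ (K.perspectivity (t', i) i) hx'').symm
    rw [← permute_facetBarycentre, ← Simplex.permute_segment, K.lift_cross] at h1
    · exact h1
    · change (1 - η.1) * a'.1 i + η.1 * (facetBarycentre hn i).1 i = 0
      rw [hi]
      simp [facetBarycentre]

theorem segment_segmentPoint_pos (hn : 3 ≤ n) (a : Simplex n) {i m : Fin (n + 1)}
    (τ : unitInterval) {η : unitInterval} (hη : 0 < η.1) (hm : m ≠ i) :
    0 < (Simplex.segment a (segmentPoint hn i τ) η).1 m := by
  have h1 := mul_pos hη (segmentPoint_pos hn i τ hm)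
  have h2 := mul_nonneg (sub_nonneg.2 η.2.2) (a.2.1 m)
  change 0 < (1 - η.1) * a.1 m + η.1 * (segmentPoint hn i τ).1 m
  linarith

theorem isGood_of_mem_contractedGraph (hn : 3 ≤ n) {x : K.Space} {η : unitInterval}
    (hη : 0 < η.1) {z : K.Space} (hz : z ∈ K.contractedGraph hn x η) : K.IsGood z := by
  obtain ⟨t, a, i, τ, -, rfl⟩ := hz
  refine K.isGood_of_le_one_zero fun k l hk hl => ?_
  have h : ∀ {m}, (Simplex.segment a (segmentPoint hn i τ) η).1 m = 0 → m = i := fun {m} hm => by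
    by_contra hne
    exact (segment_segmentPoint_pos hn a τ hη hne).ne' hm
  rw [h hk, h hl]

theorem segmentPoint_mem (hn : 3 ≤ n) (i : Fin (n + 1)) (τ : unitInterval) :
    (segmentPoint hn i τ).1 ∈ puncturedSimplex n :=
  ((convex_puncturedSimplex n).linePath (center hn) (facetCenter hn i) τ).2

/-- The dual graph can be contracted into any neighbourhood of a point of `M`. -/
theorem exists_contractedGraph_subset [Finite T] (hn : 3 ≤ n) (x : K.M) {U : Set K.M}
    (hU : IsOpen U) (hx : x ∈ U) : ∃ η : unitInterval, 0 < η.1 ∧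
      ∀ z ∈ K.contractedGraph hn x.1 η, ∃ u ∈ U, u.1 = z := by
  have key : ∀ y ∈ {y : K.Points | K.proj y = x.1}, ∀ᶠ η : ℝ in 𝓝[>] 0, ∀ hη : η ∈ unitInterval,
      ∀ i τ, ∃ u ∈ U, u.1 =
        K.proj ⟨y.1, Simplex.segment y.2 (segmentPoint hn i τ) ⟨η, hη⟩⟩ := by
    rintro ⟨t, a⟩ hy
    have ha : a.1 ∈ puncturedSimplex n :=
      ⟨a.2, K.notMem_skeleton_zero_iff.1 fun h => x.2 ⟨_, h, hy⟩⟩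
    have hax : K.toM t ⟨a.1, ha⟩ = x := Subtype.ext hy
    obtain ⟨δ, hδ, hball⟩ := Metric.isOpen_iff.1 (hU.preimage (K.toM t).continuous) ⟨a.1, ha⟩
      (by rw [Set.mem_preimage, hax]; exact hx)
    filter_upwards [Ioo_mem_nhdsGT hδ] with η hη hη' i τ
    let v := (convex_puncturedSimplex n).linePath ⟨a.1, ha⟩ ⟨_, segmentPoint_mem hn i τ⟩ ⟨η, hη'⟩
    refine ⟨K.toM t v, hball ?_, rfl⟩
    rw [Metric.mem_ball, Subtype.dist_eq]
    refine ((dist_pi_le_iff hη'.1).2 fun m => ?_).trans_lt hη.2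
    have h1 : v.1 m - a.1 m = η * ((segmentPoint hn i τ).1 m - a.1 m) := by
      change (1 - η) * a.1 m + η * (segmentPoint hn i τ).1 m - a.1 m = _
      ring
    have h2 : |(segmentPoint hn i τ).1 m - a.1 m| ≤ 1 := by
      have h3 := (segmentPoint_mem hn i τ).2 m
      have h4 := (segmentPoint hn i τ).2.1 m
      have h5 := ha.2 m
      have h6 := a.2.1 m
      rw [abs_le]
      constructor <;> linarith
    change dist (v.1 m) (a.1 m) ≤ η
    rw [Real.dist_eq, h1, abs_mul, abs_of_nonneg hη'.1]
    exact mul_le_of_le_one_right hη'.1 h2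
  -- Finiteness of the fibre gives one `η` for all points over `x`.
  have h1 := (Filter.eventually_all_finite (K.finite_fibre x.1)).2 key
  obtain ⟨η, hη, hη1⟩ := (h1.and (Ioo_mem_nhdsGT one_pos)).exists
  refine ⟨⟨η, hη1.1.le, hη1.2.le⟩, hη1.1, ?_⟩
  rintro z ⟨t, a, i, τ, ha, rfl⟩
  exact hη ⟨t, a⟩ ha _ i τ

/-- Countably many affine maps describe a piecewise affine chart. -/
theorem exists_countable_affine [Finite T] {e : OpenPartialHomeomorph K.M (EuclideanSpace ℝ (Fin n))}
    (he : ∀ (t : T) (a : Simplex n), (∃ u ∈ e.source, u.1 = K.proj ⟨t, a⟩) →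
      ∃ W ∈ 𝓝 a, ∃ A : Set ((Fin (n + 1) → ℝ) →ᵃ[ℝ] EuclideanSpace ℝ (Fin n)), A.Finite ∧
        ∀ b ∈ W, ∀ u ∈ e.source, u.1 = K.proj ⟨t, b⟩ → ∃ L ∈ A, e u = L b.1) :
    ∃ A : Set ((Fin (n + 1) → ℝ) →ᵃ[ℝ] EuclideanSpace ℝ (Fin n)), A.Countable ∧
      ∀ (t : T) (b : Simplex n), ∀ u ∈ e.source, u.1 = K.proj ⟨t, b⟩ → ∃ L ∈ A, e u = L b.1 := by
  have key : ∀ t : T, ∃ A : Set ((Fin (n + 1) → ℝ) →ᵃ[ℝ] EuclideanSpace ℝ (Fin n)), A.Countable ∧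
      ∀ b : Simplex n, ∀ u ∈ e.source, u.1 = K.proj ⟨t, b⟩ → ∃ L ∈ A, e u = L b.1 := by
    intro t
    choose! W hW A hA hL using he t
    -- The Lindelöf property reduces the local finite families to a countable one, enough for a null
    -- set argument.
    obtain ⟨c, hcs, hc, hcover⟩ := TopologicalSpace.countable_cover_nhdsWithin
      (s := {a : Simplex n | ∃ u ∈ e.source, u.1 = K.proj ⟨t, a⟩}) (f := W)
      fun a ha => mem_nhdsWithin_of_mem_nhds (hW a ha)
    refine ⟨⋃ a ∈ c, A a, hc.biUnion fun a ha => (hA a (hcs ha)).countable, fun b u hu hub => ?_⟩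
    obtain ⟨a, ha, hb⟩ := Set.mem_iUnion₂.1 (hcover ⟨u, hu, hub⟩)
    obtain ⟨L, hLA, hLe⟩ := hL a (hcs ha) b hb u hu hub
    exact ⟨L, Set.mem_iUnion₂.2 ⟨a, ha, hLA⟩, hLe⟩
  choose A hA hL using key
  refine ⟨⋃ t, A t, Set.countable_iUnion hA, fun t b u hu hub => ?_⟩
  obtain ⟨L, hLA, hLe⟩ := hL t b u hu hub
  exact ⟨L, Set.mem_iUnion.2 ⟨t, hLA⟩, hLe⟩

/-- In a piecewise affine chart, a point close to `x` can be joined by segments of good points with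
all points of the contracted dual graph. -/
theorem exists_apex [Finite T] (hn : 3 ≤ n) (hK : K.IsEven) (x : K.Space) {η : unitInterval}
    (hη : 0 < η.1) {e : OpenPartialHomeomorph K.M (EuclideanSpace ℝ (Fin n))}
    {A : Set ((Fin (n + 1) → ℝ) →ᵃ[ℝ] EuclideanSpace ℝ (Fin n))} (hA : A.Countable)
    (hL : ∀ (t : T) (b : Simplex n), ∀ u ∈ e.source, u.1 = K.proj ⟨t, b⟩ → ∃ L ∈ A, e u = L b.1)
    {V : Set (EuclideanSpace ℝ (Fin n))} (hV : IsOpen V) (hV0 : V.Nonempty) :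
    ∃ c ∈ V, ∀ u ∈ e.source, u.1 ∈ K.contractedGraph hn x η → ∀ z ∈ segment ℝ c (e u),
      z ∈ e.target → K.IsGood (e.symm z).1 := by
  let base : Bool → Fin (n + 1) → Fin (n + 1) → Fin (n + 1) → ℝ := fun b k l =>
    bif b then Pi.single l 1 else (1 / 2 : ℝ) • (Pi.single k 1 + Pi.single l 1)
  let bad : A → A → {y : K.Points // y ∈ {y : K.Points | K.proj y = x}} → Fin (n + 1) → Bool →
      Fin (n + 1) → Fin (n + 1) → {Q : Finset (Fin (n + 1)) // Q.card = 4} →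
      Set (EuclideanSpace ℝ (Fin n)) := fun L L' y i b k l Q =>
    {c | ∃ a : Fin (n + 1) → ℝ, ∃ μ : ℝ, a - base b k l ∈ Submodule.span ℝ
        ((fun m => Pi.single m 1 - base b k l) '' (Q.1ᶜ : Finset (Fin (n + 1)))) ∧
      L.1 a ∈ segment ℝ c (L'.1 ((Simplex.segment y.1.2 (barycentre n) η).1 + μ •
        ((Simplex.segment y.1.2 (facetBarycentre hn i) η).1 -
          (Simplex.segment y.1.2 (barycentre n) η).1))) ∧
      L.1 a ≠ L'.1 ((Simplex.segment y.1.2 (barycentre n) η).1 + μ •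
        ((Simplex.segment y.1.2 (facetBarycentre hn i) η).1 -
          (Simplex.segment y.1.2 (barycentre n) η).1))}
  have : Countable A := hA.to_subtype
  have : Countable {y : K.Points // y ∈ {y : K.Points | K.proj y = x}} :=
    (K.finite_fibre x).countable.to_subtype
  have hnull : MeasureTheory.volume (⋃ L, ⋃ L', ⋃ y, ⋃ i, ⋃ b, ⋃ k, ⋃ l, ⋃ Q,
      bad L L' y i b k l Q) = 0 := by
    simp only [MeasureTheory.measure_iUnion_null_iff]
    exact fun L L' y i b k l Q => volume_apexes_eq_zero hn L.1 L'.1 (base b k l) _ _ Q.2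
  obtain ⟨c, hcV, hc⟩ : ∃ c ∈ V, c ∉ ⋃ L, ⋃ L', ⋃ y, ⋃ i, ⋃ b, ⋃ k, ⋃ l, ⋃ Q,
      bad L L' y i b k l Q := by
    by_contra! hsub
    exact (hV.measure_pos MeasureTheory.volume hV0).ne'
      (MeasureTheory.measure_mono_null hsub hnull)
  refine ⟨c, hcV, ?_⟩
  rintro u hu ⟨t, a, i, τ, ha, hua⟩ z hz hzt
  by_contra hgood
  obtain ⟨⟨t', b⟩, hb⟩ := Quot.exists_rep (e.symm z).1
  change K.proj ⟨t', b⟩ = _ at hb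
  obtain ⟨L, hLA, hLe⟩ := hL t' b _ (e.map_target hzt) hb.symm
  obtain ⟨L', hLA', hLe'⟩ := hL t _ u hu hua
  rw [e.right_inv hzt] at hLe
  rw [← hb] at hgood
  obtain ⟨β, k, l, Q, hQ, hspan⟩ := K.exists_subspace_of_not_isGood hn hK hgood
  have hw : (Simplex.segment a (segmentPoint hn i τ) η).1 =
      (Simplex.segment a (barycentre n) η).1 + τ.1 •
        ((Simplex.segment a (facetBarycentre hn i) η).1 -
          (Simplex.segment a (barycentre n) η).1) := by
    change (1 - η.1) • a.1 + η.1 • ((1 - τ.1) • (barycentre n).1 + τ.1 • (facetBarycentre hn i).1) =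
      ((1 - η.1) • a.1 + η.1 • (barycentre n).1) + τ.1 •
        (((1 - η.1) • a.1 + η.1 • (facetBarycentre hn i).1) -
          ((1 - η.1) • a.1 + η.1 • (barycentre n).1))
    module
  refine hc ?_
  simp only [Set.mem_iUnion]
  refine ⟨⟨L, hLA⟩, ⟨L', hLA'⟩, ⟨⟨t, a⟩, ha⟩, i, β, k, l, ⟨Q, hQ⟩, b.1, τ.1, hspan, ?_, ?_⟩
  · dsimp only
    rw [← hw, ← hLe, ← hLe']
    exact hz
  · dsimp only
    rw [← hw, ← hLe, ← hLe']
    -- The point of the graph itself, which the null sets leave out, is good anyway.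
    rintro rfl
    rw [e.left_inv hu] at hb
    rw [hb] at hgood
    exact hgood (K.isGood_of_mem_contractedGraph hn hη ⟨t, a, i, τ, ha, hua⟩)

/-- Two labels identified at `x` are joined by a path over the contracted graph. Its image is a loop
that contracts, in the chart, inside a star-shaped set of good points, so the path is closed and the
labels agree. -/
theorem IsPLManifold.isGood [Finite T] (hn : 3 ≤ n) (hK : K.IsEven) (hM : K.IsPLManifold)
    (x : K.M) : K.IsGood x.1 := by
  obtain ⟨e, hxe, he⟩ := hM x
  obtain ⟨A, hA, hL⟩ := K.exists_countable_affine he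
  obtain ⟨r, hr, hball⟩ := Metric.isOpen_iff.1 e.open_target (e x) (e.map_source hxe)
  obtain ⟨η, hη, hsub⟩ := K.exists_contractedGraph_subset hn x
    (e.isOpen_inter_preimage (Metric.isOpen_ball (x := e x) (ε := r)))
    ⟨hxe, Metric.mem_ball_self hr⟩
  obtain ⟨c, hcV, hc⟩ := K.exists_apex hn hK x.1 hη hA hL (Metric.isOpen_ball (x := e x) (ε := r))
    ⟨e x, Metric.mem_ball_self hr⟩
  let S : Set (EuclideanSpace ℝ (Fin n)) :=
    {z | z ∈ Metric.ball (e x) r ∧ ∀ z' ∈ segment ℝ c z, K.IsGood (e.symm z').1}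
  have hconv := convex_ball (e x) r
  have hstar : StarConvex ℝ c S := by
    rw [starConvex_iff_segment_subset]
    rintro z ⟨hz, hz'⟩ z₁ hz₁
    refine ⟨hconv.segment_subset hcV hz hz₁, fun z₂ hz₂ => hz' _ ?_⟩
    exact (convex_segment c z).segment_subset (left_mem_segment ℝ c z) hz₁ hz₂
  have hSmem : ∀ u : K.M, u.1 ∈ K.contractedGraph hn x.1 η → u ∈ e.source ∧ e u ∈ S := by
    intro u hu
    obtain ⟨u', ⟨hu', hur⟩, huu⟩ := hsub _ hu
    obtain rfl : u' = u := Subtype.ext huu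
    exact ⟨hu', hur, fun z hz => hc u' hu' hu z hz (hball (hconv.segment_subset hcV hur hz))⟩
  have hcont : Continuous fun z : S => (e.symm z.1).1 :=
    continuous_subtype_val.comp (e.continuousOn_symm.comp_continuous continuous_subtype_val
      fun z => hball z.2.1)
  obtain ⟨t, w, hw⟩ := K.exists_toM_eq x
  have hx : K.proj ⟨t, ⟨w.1, w.2.1⟩⟩ = x.1 := congrArg Subtype.val hw
  rw [← hx]
  refine K.isGood_of_forall fun s s' hss => ?_
  set a : Simplex n := ⟨w.1, w.2.1⟩
  obtain ⟨γ, hγ⟩ := K.joinedIn_contractedGraph hn η hx hss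
  have hM' : ∀ τ, K.forget (γ τ) ∉ K.proj '' K.skeleton 0 := by
    intro τ
    obtain ⟨u, -, hu⟩ := hsub _ (hγ τ)
    rw [← hu]
    exact u.2
  let m : unitInterval → K.M := fun τ => ⟨K.forget (γ τ), hM' τ⟩
  have hm : Continuous m := (K.continuous_forget.comp γ.continuous).subtype_mk _
  have hm01 : m 1 = m 0 := Subtype.ext (by
    change K.forget (γ 1) = K.forget (γ 0)
    rw [γ.source, γ.target]
    rfl)
  let f : unitInterval → S := fun τ => ⟨e (m τ), (hSmem (m τ) (hγ τ)).2⟩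
  have hf : Continuous f := (e.continuousOn.comp_continuous hm
    fun τ => (hSmem (m τ) (hγ τ)).1).subtype_mk _
  let α : Path (f 0) (f 0) := ⟨⟨f, hf⟩, rfl, by
    change f 1 = f 0
    refine Subtype.ext ?_
    change e (m 1) = e (m 0)
    rw [hm01]⟩
  have := hstar.contractibleSpace ⟨_, (f 0).2⟩
  have hback : ∀ τ, (e.symm (f τ).1).1 = K.forget (γ τ) := fun τ =>
    congrArg Subtype.val (e.left_inv (hSmem (m τ) (hγ τ)).1)
  have hend := K.eq_of_homotopic_forget ⟨fun z : S => (e.symm z.1).1, hcont⟩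
    (fun z => z.2.2 _ (right_mem_segment ℝ c z.1))
    (SimplyConnectedSpace.paths_homotopic α (Path.refl _)) γ (Path.refl _)
    (fun τ => (hback τ).symm) (fun τ => ((hback 0).trans (congrArg K.forget γ.source)).symm)
  -- The ends of the path are interior to the labelled simplices, where a point determines the
  -- label.
  refine K.isGood_of_le_one_zero ?_ t (Simplex.segment a (barycentre n) η) s s' rfl hend.symm
  intro i j hi
  have h1 : ∀ m, 0 < (Simplex.segment a (barycentre n) η).1 m := fun m => by
    have : (n + 1) ≠ 1 := by omega
    obtain ⟨l, hl⟩ : ∃ l : Fin (n + 1), m ≠ l := by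
      by_contra! hall
      have h0 : m.1 = 0 := by rw [hall 0]; rfl
      have h2 := congrArg Fin.val (hall (Fin.last n))
      simp only [Fin.val_last] at h2
      omega
    have := segment_segmentPoint_pos hn a 0 hη hl
    rwa [segmentPoint_zero] at this
  exact absurd hi (h1 i).ne'

/-- Three zero coordinates in a tetrahedron give a vertex, so a point of `M` on two facets lies in
the relative interior of an edge. -/
theorem isGood_of_eq_three (hn : n = 3) (hK : K.IsEven) (x : K.M) : K.IsGood x.1 := by
  obtain ⟨t, u, rfl⟩ := K.exists_toM_eq x
  rw [toM_val]
  by_cases h : ∀ i j, u.1 i = 0 → u.1 j = 0 → i = j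
  · exact K.isGood_of_le_one_zero h
  · push Not at h
    obtain ⟨i, j, hi, hj, hij⟩ := h
    refine K.isGood_of_hasZeros (x := ⟨(t, i, j), hij⟩)
      ((K.isEven_iff_even_period hn.ge).1 hK _) ⟨rfl, fun k => ⟨fun hk => ?_, ?_⟩⟩ (Or.inl hn)
    · by_contra hne
      rw [not_or] at hne
      dsimp only at hne hk
      have hcard : ({i, j, k}ᶜ : Finset (Fin (n + 1))).card = 1 := by
        rw [Finset.card_compl, Finset.card_eq_three.2 ⟨i, j, k, hij, Ne.symm hne.1, Ne.symm hne.2,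
          rfl⟩, Fintype.card_fin, hn]
      obtain ⟨l, hl⟩ := Finset.card_eq_one.1 hcard
      have hsum := u.2.1.2
      rw [← Finset.sum_add_sum_compl {i, j, k}, hl, Finset.sum_singleton,
        Finset.sum_eq_zero, zero_add] at hsum
      · exact (u.2.2 l).ne hsum
      · intro m hm
        simp only [Finset.mem_insert, Finset.mem_singleton] at hm
        rcases hm with rfl | rfl | rfl
        exacts [hi, hj, hk]
    · rintro (rfl | rfl)
      exacts [hi, hj]

/-! ### The representation of the fundamental group. -/

/-- If all points of `M` are good, then the projectivities define a representation of the
fundamental group. -/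
theorem exists_isCanonicalRep (hn : 3 ≤ n) (hgood : ∀ x : K.M, K.IsGood x.1) (t₀ : T) :
    ∃ ρ : FundamentalGroup K.M (K.dualVertex hn t₀) →* Equiv.Perm (Fin (n + 1)),
      K.IsCanonicalRep hn t₀ ρ := by
  have wd : ∀ γ δ : K.DualPath t₀ t₀, Path.Homotopic.Quotient.mk (γ.toPath hn) =
      .mk (δ.toPath hn) → γ.projectivity = δ.projectivity := by
    intro γ δ h
    obtain ⟨Γ, hΓ⟩ := γ.exists_lift hn 1
    obtain ⟨Δ, hΔ⟩ := δ.exists_lift hn 1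
    have hend := K.eq_of_homotopic_forget ⟨fun x : K.M => x.1, continuous_subtype_val⟩ hgood
      (Path.Homotopic.Quotient.eq.1 h) Γ Δ hΓ hΔ
    rw [mul_one, mul_one] at hend
    exact hgood (K.dualVertex hn t₀) t₀ _ _ _ rfl hend
  choose δ hδ using fun a : FundamentalGroup K.M (K.dualVertex hn t₀) => exists_dualPath_eq hn a
  refine ⟨MonoidHom.mk' (fun a => (δ a).projectivity) fun a b => ?_, fun a s => ⟨?_, ?_⟩⟩
  -- In the product of `a` and `b` the edge path of `b` runs first, in agreement with composition of
  -- permutations.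
  · rw [← DualPath.projectivity_append]
    refine wd _ _ ?_
    rw [DualPath.mk_toPath_append, hδ, hδ, hδ]
    rfl
  · rintro rfl
    exact ⟨δ a, hδ a, rfl⟩
  · rintro ⟨γ, hγ, rfl⟩
    exact wd _ _ ((hδ a).trans hγ.symm)

end Triangulation

theorem mainTheorem5 {n : ℕ} (hn : 3 ≤ n) {T : Type*} [Finite T] (K : Triangulation n T)
    [ConnectedSpace K.Space] (t₀ : T) :
    ((∃ ρ : FundamentalGroup K.M (K.dualVertex hn t₀) →* Equiv.Perm (Fin (n + 1)),
        K.IsCanonicalRep hn t₀ ρ) → K.IsEven) ∧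
    (n = 3 ∨ K.IsPLManifold → K.IsEven →
      ∃ ρ : FundamentalGroup K.M (K.dualVertex hn t₀) →* Equiv.Perm (Fin (n + 1)),
        K.IsCanonicalRep hn t₀ ρ) := by
  refine ⟨fun ⟨ρ, hρ⟩ => Triangulation.IsCanonicalRep.isEven K hρ, fun h hK => ?_⟩
  refine K.exists_isCanonicalRep hn (fun x => ?_) t₀
  rcases h with h | h
  · exact K.isGood_of_eq_three h hK x
  · exact Triangulation.IsPLManifold.isGood K hn hK h x
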